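/- Let $H$ be a separable real Hilbert space with inner product $(\cdot,\cdot)$ and let $\xi=\{(\varphi,\xi):\varphi\in H\}$ be a generalized Gaussian random element in $H$ with zero mean and identity covariation (an isonormal process) on a probability space: a jointly Gaussian family, linear in $\varphi$ (a.s.), with $(\varphi,\xi)\sim N(0,\|\varphi\|^2)$. A smooth cylindrical random variable is $F=f((\varphi_1,\xi),\dots,(\varphi_n,\xi))$ with $\varphi_i\in H$ and $f\in C^\infty(\mathbb R^n)$ bounded together with all its derivatives; put $DF=\sum_i\partial_if((\varphi_1,\xi),\dots,(\varphi_n,\xi))\,\varphi_i$. Smooth cylindrical random elements in $H$ are the finite sums $\sum_jF_jk_j$ with $k_j\in H$, with $D$ and $D^2$ acting on the coefficients $F_j$. The stochastic derivative $D$ of random variables is the $L^2$-closure of $D$ on smooth cylindrical variables. A random element $x$ in $H$ has two stochastic derivatives $Dx$, $D^2x$ if $(x,Dx,D^2x)$ is a limit of triples $(F,DF,D^2F)$ with $F$ smooth cylindrical, in mean square for the norm of $H$ and the Hilbert–Schmidt norms; $(Dx,h)$ denotes the derivative of $x$ in the direction $h$, a random element in $H$. For a $\sigma(\xi)$-measurable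 square integrable random element $y$ in $H$, the extended (Skorokhod) integral $I(y)$ is the $\sigma(\xi)$-measurable $\eta\in L^2$ with $E(y,DF)=E\,\eta F$ for all smooth cylindrical $F$, if it exists; if the same holds with $\eta$ only in $L^1$, we say that $I(y)=\eta$ exists in the $L^1$ sense. Let $x$ have two stochastic derivatives. Then $I(x)$ exists (in $L^2$), and the following holds. 1) For every bounded stochastically differentiable random variable $\alpha$, the integral $I(\alpha x)$ exists in the $L^1$ sense and, almost surely, $$\alpha I(x)=I(\alpha x)+(x,D\alpha).$$ Moreover $I(\alpha x)$ exists in the $L^2$ sense if and only if $(x,D\alpha)\in L^2$. 2) $I(x)$ is stochastically differentiable and, for every $h\in H$, $I((Dx,h))$ exists (in $L^2$) and, almost surely, $$(DI(x),h)=(x,h)+I((Dx,h)).$$ -/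

import Mathlib

open MeasureTheory ProbabilityTheory Filter Topology
open scoped ENNReal RealInnerProductSpace

noncomputable section

namespace Malliavin

variable {H : Type*} [NormedAddCommGroup H] [InnerProductSpace ℝ H]
variable {Ω : Type*} [MeasurableSpace Ω]

/-- A generalized Gaussian random element in `H` with zero mean and identity covariation
(an isonormal process): a jointly Gaussian family `(φ, ξ) = ξ φ`, `φ ∈ H`, such that
`(φ, ξ)` is centred normal with variance `‖φ‖²` and depends linearly (almost surely) on `φ`. -/
structure IsIsonormal (ξ : H → Ω → ℝ) (P : Measure Ω) : Prop where
  measurable : ∀ φ, Measurable (ξ φ)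
  gaussian : IsGaussianProcess ξ P
  hasLaw : ∀ φ, HasLaw (ξ φ) (gaussianReal 0 (‖φ‖₊ ^ 2)) P
  linear : ∀ (a b : ℝ) (φ ψ : H), ξ (a • φ + b • ψ) =ᵐ[P] fun ω => a * ξ φ ω + b * ξ ψ ω

/-- The σ-algebra `σ(ξ)` generated by all the variables `(φ, ξ)`. -/
abbrev sigmaAlgebra (ξ : H → Ω → ℝ) : MeasurableSpace Ω :=
  ⨆ φ, MeasurableSpace.comap (ξ φ) inferInstance

/-! ### Smooth cylindrical functionals -/

/-- The data of a smooth cylindrical random variable `f((φ₁, ξ), …, (φₙ, ξ))`, where `f` is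
infinitely differentiable and bounded together with all its derivatives. -/
structure Cylinder (H : Type*) where
  n : ℕ
  dir : Fin n → H
  f : (Fin n → ℝ) → ℝ
  contDiff : ContDiff ℝ (⊤ : ℕ∞) f
  bounded : ∀ k : ℕ, ∃ C : ℝ, ∀ p, ‖iteratedFDeriv ℝ k f p‖ ≤ C

namespace Cylinder

/-- The point `((φ₁, ξ), …, (φₙ, ξ))`. -/
def point (F : Cylinder H) (ξ : H → Ω → ℝ) (ω : Ω) : Fin F.n → ℝ :=
  fun i => ξ (F.dir i) ω

/-- The random variable `f((φ₁, ξ), …, (φₙ, ξ))`. -/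
def val (F : Cylinder H) (ξ : H → Ω → ℝ) (ω : Ω) : ℝ :=
  F.f (F.point ξ ω)

/-- Its derivative `∑ᵢ ∂ᵢf((φ₁, ξ), …, (φₙ, ξ)) φᵢ`, a random element in `H`. -/
def grad (F : Cylinder H) (ξ : H → Ω → ℝ) (ω : Ω) : H :=
  ∑ i, (fderiv ℝ F.f (F.point ξ ω) (Pi.single i 1)) • F.dir i

/-- Its second derivative, the random bilinear form
`(u, v) ↦ ∑ᵢⱼ ∂ᵢ∂ⱼf((φ₁, ξ), …, (φₙ, ξ)) (φᵢ, u) (φⱼ, v)`. -/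
def hess (F : Cylinder H) (ξ : H → Ω → ℝ) (ω : Ω) : H →L[ℝ] H →L[ℝ] ℝ :=
  ∑ i, ∑ j, (fderiv ℝ (fderiv ℝ F.f) (F.point ξ ω) (Pi.single i 1) (Pi.single j 1)) •
    (innerSL ℝ (F.dir i)).smulRight (innerSL ℝ (F.dir j))

end Cylinder

/-- The data of a smooth cylindrical random element `∑ⱼ Fⱼ kⱼ` in `H`: a finite sum with smooth
cylindrical random variables `Fⱼ` and vectors `kⱼ ∈ H`. -/
structure VecCylinder (H : Type*) where
  m : ℕ
  coeff : Fin m → Cylinder H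
  vec : Fin m → H

namespace VecCylinder

/-- The random element `∑ⱼ Fⱼ kⱼ`. -/
def val (F : VecCylinder H) (ξ : H → Ω → ℝ) (ω : Ω) : H :=
  ∑ j, (F.coeff j).val ξ ω • F.vec j

/-- Its derivative, the random operator `u ↦ ∑ⱼ (DFⱼ, u) kⱼ`. -/
def deriv (F : VecCylinder H) (ξ : H → Ω → ℝ) (ω : Ω) : H →L[ℝ] H :=
  ∑ j, (innerSL ℝ ((F.coeff j).grad ξ ω)).smulRight (F.vec j)

/-- Its second derivative, the random bilinear map `(u, v) ↦ ∑ⱼ D²Fⱼ(u, v) kⱼ`. -/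
def deriv2 (F : VecCylinder H) (ξ : H → Ω → ℝ) (ω : Ω) : H →L[ℝ] H →L[ℝ] H :=
  ∑ j, (ContinuousLinearMap.smulRightL ℝ H H).flip (F.vec j) ∘L (F.coeff j).hess ξ ω

end VecCylinder

/-! ### Hilbert-Schmidt norms -/

section HilbertSchmidt

theorem enorm_sq_eq_tsum {ι : Type*} (b : HilbertBasis ι ℝ H) (x : H) :
    ‖x‖ₑ ^ 2 = ∑' i, ‖⟪x, b i⟫‖ₑ ^ 2 := by
  have h := b.hasSum_inner_mul_inner x x
  have h1 : ∀ i, ⟪x, b i⟫ * ⟪b i, x⟫ = ‖⟪x, b i⟫‖ ^ 2 := fun i => by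
    rw [real_inner_comm x (b i), Real.norm_eq_abs, sq_abs, sq]
  simp only [h1] at h
  rw [real_inner_self_eq_norm_sq] at h
  rw [← ofReal_norm, ← ENNReal.ofReal_pow (norm_nonneg _), ← h.tsum_eq,
    ENNReal.ofReal_tsum_of_nonneg (fun i => sq_nonneg _) h.summable]
  exact tsum_congr fun i => by
    rw [ENNReal.ofReal_pow (norm_nonneg _), ofReal_norm]

/-- The index set of some orthonormal basis of `H`. -/
def basisIndex (H : Type*) [NormedAddCommGroup H] [InnerProductSpace ℝ H] [CompleteSpace H] :
    Set H :=
  (exists_hilbertBasis ℝ H).choose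

/-- Some orthonormal basis of `H`. -/
def basis (H : Type*) [NormedAddCommGroup H] [InnerProductSpace ℝ H] [CompleteSpace H] :
    HilbertBasis (basisIndex H) ℝ H :=
  (exists_hilbertBasis ℝ H).choose_spec.choose

variable [CompleteSpace H]

/-- The squared Hilbert-Schmidt norm `∑ᵢ ‖T eᵢ‖²` (possibly infinite). -/
def hsSq (T : H →L[ℝ] H) : ℝ≥0∞ :=
  ∑' i, ‖T (basis H i)‖ₑ ^ 2

/-- The squared Hilbert-Schmidt norm `∑ᵢⱼ ‖T(eᵢ, eⱼ)‖²` of a bilinear map. -/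
def hsSq2 (T : H →L[ℝ] H →L[ℝ] H) : ℝ≥0∞ :=
  ∑' i, ∑' j, ‖T (basis H i) (basis H j)‖ₑ ^ 2

theorem hsSq_aux {ι κ : Type*} (b : HilbertBasis ι ℝ H) (c : HilbertBasis κ ℝ H)
    (T : H →L[ℝ] H) :
    ∑' i, ‖T (b i)‖ₑ ^ 2 = ∑' j, ‖ContinuousLinearMap.adjoint T (c j)‖ₑ ^ 2 := by
  simp_rw [fun i => enorm_sq_eq_tsum c (T (b i))]
  rw [ENNReal.tsum_comm]
  refine tsum_congr fun j => ?_
  rw [enorm_sq_eq_tsum b]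
  refine tsum_congr fun i => ?_
  rw [ContinuousLinearMap.adjoint_inner_left, real_inner_comm]

/-- The Hilbert-Schmidt norm does not depend on the orthonormal basis. -/
theorem hsSq_eq {ι : Type*} (b : HilbertBasis ι ℝ H) (T : H →L[ℝ] H) :
    hsSq T = ∑' i, ‖T (b i)‖ₑ ^ 2 := by
  rw [hsSq, hsSq_aux (basis H) (basis H), hsSq_aux b (basis H)]

end HilbertSchmidt

/-! ### Stochastic derivative and extended stochastic integral -/

/-- `Dα` is the stochastic derivative of the random variable `α`: the pair `(α, Dα)` lies in the
closure in `L²(Ω) × L²(Ω; H)` of the pairs `(F, DF)` with `F` smooth cylindrical. -/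
def HasStochDeriv (ξ : H → Ω → ℝ) (P : Measure Ω) (α : Ω → ℝ) (Dα : Ω → H) : Prop :=
  MemLp α 2 P ∧ MemLp Dα 2 P ∧
    ∃ F : ℕ → Cylinder H,
      Tendsto (fun n => eLpNorm (fun ω => (F n).val ξ ω - α ω) 2 P) atTop (𝓝 0) ∧
      Tendsto (fun n => eLpNorm (fun ω => (F n).grad ξ ω - Dα ω) 2 P) atTop (𝓝 0)

/-- `Dx` and `D2x` are the first and second stochastic derivatives of the random element `x`
in `H`: the triple `(x, Dx, D²x)` is a limit, in mean square with respect to the norm of `H` and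
the Hilbert-Schmidt norms, of triples `(F, DF, D²F)` with `F` smooth cylindrical. Here
`Dx ω u` is the derivative of `x` in the direction `u`, so that `(Dx, h) = Dx · h`. -/
def HasTwoStochDerivs [CompleteSpace H] (ξ : H → Ω → ℝ) (P : Measure Ω) (x : Ω → H)
    (Dx : Ω → H →L[ℝ] H) (D2x : Ω → H →L[ℝ] H →L[ℝ] H) : Prop :=
  MemLp x 2 P ∧
    (∀ u, AEStronglyMeasurable (fun ω => Dx ω u) P) ∧
    (∀ u v, AEStronglyMeasurable (fun ω => D2x ω u v) P) ∧
    ∃ F : ℕ → VecCylinder H,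
      Tendsto (fun n => eLpNorm (fun ω => (F n).val ξ ω - x ω) 2 P) atTop (𝓝 0) ∧
      Tendsto (fun n => ∫⁻ ω, hsSq ((F n).deriv ξ ω - Dx ω) ∂P) atTop (𝓝 0) ∧
      Tendsto (fun n => ∫⁻ ω, hsSq2 ((F n).deriv2 ξ ω - D2x ω) ∂P) atTop (𝓝 0)

/-- The integrable random variable `η` is the extended stochastic integral `I(y)` of the square
integrable random element `y` in `H`, in the sense of `L¹`: both are measurable with respect to
`σ(ξ)` (up to null sets) and `E (y, DF) = E η F` for all smooth cylindrical `F`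
(for which `F` and `DF` are bounded). -/
def HasIntegralL1 (ξ : H → Ω → ℝ) (P : Measure Ω) (y : Ω → H) (η : Ω → ℝ) : Prop :=
  MemLp y 2 P ∧ AEStronglyMeasurable[sigmaAlgebra ξ] y P ∧
    Integrable η P ∧ AEStronglyMeasurable[sigmaAlgebra ξ] η P ∧
    ∀ F : Cylinder H, ∫ ω, ⟪y ω, F.grad ξ ω⟫ ∂P = ∫ ω, η ω * F.val ξ ω ∂P

/-- `η` is the extended stochastic (Skorokhod) integral `I(y)`, as the adjoint of the
derivative `D : L²(Ω, σ(ξ), P) → L²(Ω, σ(ξ), P; H)`: here `η` is square integrable. -/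
def HasIntegral (ξ : H → Ω → ℝ) (P : Measure Ω) (y : Ω → H) (η : Ω → ℝ) : Prop :=
  HasIntegralL1 ξ P y η ∧ MemLp η 2 P

end Malliavin

end

/-! Everything is computed explicitly on cylindrical elements, bounded in mean square, and extended
by closedness.

The source is Gaussian integration by parts, E F (k, ξ) = E (k, DF) (`integral_val_mul`): split the
directions of F into multiples of k and vectors orthogonal to k. The orthogonal coordinates are
independent of (k, ξ), so Fubini reduces the claim to Stein's identity on the line. Applied to a
product GF, it gives I(Gk) = G (k, ξ) - (DG, k), hence I(F) for every cylindrical element F = ∑ F_j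
k_j.

For such F, symmetry of second derivatives gives the commutation relation pointwise
(`inner_skorohodGrad`). Duality, commutation and duality again give E I(F)² = E‖F‖² + E tr((DF)²),
and the trace is at most ‖DF‖² in the Hilbert-Schmidt norm. The same estimate for each (DF, e_i),
summed over an orthonormal basis, bounds E‖DI(F)‖² by the norms of F, DF and D²F. So if F_n
approximates x with two derivatives, I(F_n) and DI(F_n) are Cauchy. The limits are I(x) and its
derivative, and (DI(x), h) - (x, h) is the limit of I((DF_n, h)), hence the integral of (Dx, h)
(`exists_integral`).

The product formula is duality between x and Gα for a cylindrical test variable G, since D(Gα) = G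
Dα + α DG (`HasIntegral.smul`).

The almost sure identities for arbitrary versions rest on uniqueness: an integrable σ(ξ)-measurable
variable orthogonal to all cylindrical variables vanishes (`ae_eq_zero_of_forall_integral_mul_val`),
because its Fourier transforms along all finite families of coordinates are zero. -/

set_option linter.unusedSectionVars false

noncomputable section

namespace Malliavin

/-! ### Smooth functions bounded together with all their derivatives -/

section SmoothBdd

variable {E F G : Type*} [NormedAddCommGroup E] [NormedSpace ℝ E] [NormedAddCommGroup F]
  [NormedSpace ℝ F] [NormedAddCommGroup G] [NormedSpace ℝ G]

/-- `f` is infinitely differentiable and bounded together with all its derivatives. -/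
structure SmoothBdd (f : E → F) : Prop where
  contDiff : ContDiff ℝ (⊤ : ℕ∞) f
  bounded : ∀ k : ℕ, ∃ C : ℝ, ∀ p, ‖iteratedFDeriv ℝ k f p‖ ≤ C

namespace SmoothBdd

theorem const (c : F) : SmoothBdd (fun _ : E => c) := by
  refine ⟨contDiff_const, fun k => ⟨‖c‖, fun p => ?_⟩⟩
  rcases k with _ | k
  · simp
  · rw [iteratedFDeriv_const_of_ne (by simp)]
    simp

theorem differentiable {f : E → F} (hf : SmoothBdd f) : Differentiable ℝ f :=
  hf.contDiff.differentiable (by simp)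

theorem exists_norm_le {f : E → F} (hf : SmoothBdd f) : ∃ C, ∀ p, ‖f p‖ ≤ C := by
  simpa using hf.bounded 0

theorem add {f g : E → F} (hf : SmoothBdd f) (hg : SmoothBdd g) :
    SmoothBdd (fun p => f p + g p) := by
  refine ⟨hf.contDiff.add hg.contDiff, fun k => ?_⟩
  obtain ⟨C, hC⟩ := hf.bounded k
  obtain ⟨C', hC'⟩ := hg.bounded k
  refine ⟨C + C', fun p => ?_⟩
  have h := iteratedFDeriv_add_apply (x := p) (i := k) (f := f) (g := g)
    ((hf.contDiff.of_le (by exact_mod_cast le_top)).contDiffAt)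
    ((hg.contDiff.of_le (by exact_mod_cast le_top)).contDiffAt)
  change ‖iteratedFDeriv ℝ k (f + g) p‖ ≤ _
  rw [h]
  exact (norm_add_le _ _).trans (add_le_add (hC p) (hC' p))

theorem mul {f g : E → ℝ} (hf : SmoothBdd f) (hg : SmoothBdd g) :
    SmoothBdd (fun p => f p * g p) := by
  refine ⟨hf.contDiff.mul hg.contDiff, fun k => ?_⟩
  choose C hC using hf.bounded
  choose C' hC' using hg.bounded
  refine ⟨∑ i ∈ Finset.range (k + 1), (k.choose i : ℝ) * C i * C' (k - i), fun p => ?_⟩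
  refine (norm_iteratedFDeriv_mul_le hf.contDiff hg.contDiff p (by exact_mod_cast le_top)).trans ?_
  refine Finset.sum_le_sum fun i _ => ?_
  have := (norm_nonneg _).trans (hC i p)
  gcongr
  · exact hC i p
  · exact hC' _ p

theorem compCLM {f : F → G} (hf : SmoothBdd f) (L : E →L[ℝ] F) :
    SmoothBdd (fun p => f (L p)) := by
  refine ⟨hf.contDiff.comp L.contDiff, fun k => ?_⟩
  obtain ⟨C, hC⟩ := hf.bounded k
  refine ⟨C * ∏ _i : Fin k, ‖L‖, fun p => ?_⟩
  change ‖iteratedFDeriv ℝ k (f ∘ L) p‖ ≤ _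
  rw [L.iteratedFDeriv_comp_right hf.contDiff p (by exact_mod_cast le_top)]
  refine (ContinuousMultilinearMap.norm_compContinuousLinearMap_le _ _).trans ?_
  gcongr
  exact hC _

theorem clmComp {f : E → F} (hf : SmoothBdd f) (L : F →L[ℝ] G) :
    SmoothBdd (fun p => L (f p)) := by
  refine ⟨L.contDiff.comp hf.contDiff, fun k => ?_⟩
  obtain ⟨C, hC⟩ := hf.bounded k
  refine ⟨‖L‖ * C, fun p => ?_⟩
  refine (L.norm_iteratedFDeriv_comp_left (hf.contDiff.contDiffAt)
    (by exact_mod_cast le_top)).trans ?_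
  gcongr
  exact hC _

theorem fderiv {f : E → F} (hf : SmoothBdd f) : SmoothBdd (fderiv ℝ f) := by
  refine ⟨hf.contDiff.fderiv_right (by simp), fun k => ?_⟩
  obtain ⟨C, hC⟩ := hf.bounded (k + 1)
  exact ⟨C, fun p => by rw [norm_iteratedFDeriv_fderiv]; exact hC p⟩

theorem fderiv_apply {f : E → F} (hf : SmoothBdd f) (v : E) :
    SmoothBdd (fun p => _root_.fderiv ℝ f p v) :=
  hf.fderiv.clmComp (ContinuousLinearMap.apply ℝ F v)

/-- Differentiation exchanges sine and cosine up to sign, so the two bounds go through one joint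
induction. Both functions serve below: as real and imaginary parts of characters, and sine also as a
bounded substitute for the identity. -/
theorem norm_iteratedFDeriv_sin_cos_le (k : ℕ) :
    (∀ t, ‖iteratedFDeriv ℝ k Real.sin t‖ ≤ 1) ∧ ∀ t, ‖iteratedFDeriv ℝ k Real.cos t‖ ≤ 1 := by
  simp only [norm_iteratedFDeriv_eq_norm_iteratedDeriv]
  induction k with
  | zero => simpa using ⟨Real.abs_sin_le_one, Real.abs_cos_le_one⟩
  | succ k ih =>
    have h : deriv Real.cos = -Real.sin := by ext t; simp
    simp only [iteratedDeriv_succ', Real.deriv_sin, h, iteratedDeriv_neg, norm_neg]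
    exact ⟨ih.2, ih.1⟩

theorem sin : SmoothBdd Real.sin :=
  ⟨Real.contDiff_sin, fun k => ⟨1, (norm_iteratedFDeriv_sin_cos_le k).1⟩⟩

theorem cos : SmoothBdd Real.cos :=
  ⟨Real.contDiff_cos, fun k => ⟨1, (norm_iteratedFDeriv_sin_cos_le k).2⟩⟩

end SmoothBdd

end SmoothBdd

section

/-! ### Operations on smooth cylindrical random variables -/

variable {H : Type*} [NormedAddCommGroup H] [InnerProductSpace ℝ H]
variable {Ω : Type*}

namespace Cylinder

theorem smoothBdd (F : Cylinder H) : SmoothBdd F.f := ⟨F.contDiff, F.bounded⟩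

/-- The cylindrical random variable of a smooth bounded function. -/
def mk' {n : ℕ} (dir : Fin n → H) (f : (Fin n → ℝ) → ℝ) (hf : SmoothBdd f) : Cylinder H :=
  ⟨n, dir, f, hf.contDiff, hf.bounded⟩

/-- Restriction of coordinates to the first block. -/
def fstL (m n : ℕ) : (Fin (m + n) → ℝ) →L[ℝ] (Fin m → ℝ) :=
  ContinuousLinearMap.pi fun i => ContinuousLinearMap.proj (Fin.castAdd n i)

/-- Restriction of coordinates to the second block. -/
def sndL (m n : ℕ) : (Fin (m + n) → ℝ) →L[ℝ] (Fin n → ℝ) :=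
  ContinuousLinearMap.pi fun i => ContinuousLinearMap.proj (Fin.natAdd m i)

theorem fstL_single_castAdd (m n : ℕ) (i : Fin m) :
    fstL m n (Pi.single (Fin.castAdd n i) 1) = Pi.single i 1 := by
  ext j
  simp [fstL, Pi.single_apply]

theorem fstL_single_natAdd (m n : ℕ) (i : Fin n) :
    fstL m n (Pi.single (Fin.natAdd m i) 1) = 0 := by
  ext j
  have h : Fin.castAdd n j ≠ Fin.natAdd m i := fun h => by
    have := congrArg Fin.val h; simp at this; omega
  simp [fstL, h]

theorem sndL_single_natAdd (m n : ℕ) (i : Fin n) :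
    sndL m n (Pi.single (Fin.natAdd m i) 1) = Pi.single i 1 := by
  ext j
  simp [sndL, Pi.single_apply]

theorem sndL_single_castAdd (m n : ℕ) (i : Fin m) :
    sndL m n (Pi.single (Fin.castAdd n i) 1) = 0 := by
  ext j
  have h : Fin.natAdd m j ≠ Fin.castAdd n i := fun h => by
    have := congrArg Fin.val h; simp at this; omega
  simp [sndL, h]

/-- Constant random variables. -/
def const (H : Type*) (c : ℝ) : Cylinder H := mk' (n := 0) Fin.elim0 _ (SmoothBdd.const c)

/-- The sum of two cylindrical random variables. -/
def add (F G : Cylinder H) : Cylinder H :=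
  mk' (Fin.append F.dir G.dir) (fun p => F.f (fstL F.n G.n p) + G.f (sndL F.n G.n p))
    ((F.smoothBdd.compCLM _).add (G.smoothBdd.compCLM _))

/-- The product of two cylindrical random variables. -/
def mul (F G : Cylinder H) : Cylinder H :=
  mk' (Fin.append F.dir G.dir) (fun p => F.f (fstL F.n G.n p) * G.f (sndL F.n G.n p))
    ((F.smoothBdd.compCLM _).mul (G.smoothBdd.compCLM _))

/-- The random variable `(DF, h)`. -/
def dirDeriv (F : Cylinder H) (h : H) : Cylinder H :=
  mk' F.dir (fun p => fderiv ℝ F.f p fun i => ⟪F.dir i, h⟫) (F.smoothBdd.fderiv_apply _)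

/-- The random variable `g((φ, ξ))`. -/
def ofFun (g : ℝ → ℝ) (hg : SmoothBdd g) (φ : H) : Cylinder H :=
  mk' (n := 1) (fun _ => φ) (fun p => g (p 0))
    (hg.compCLM (ContinuousLinearMap.proj (R := ℝ) (φ := fun _ : Fin 1 => ℝ) 0))

variable (ξ : H → Ω → ℝ) (ω : Ω) (F G : Cylinder H)

@[simp] theorem val_const (c : ℝ) : (const H c).val ξ ω = c := rfl

@[simp] theorem grad_const (c : ℝ) : (const H c).grad ξ ω = 0 :=
  Finset.sum_eq_zero fun i _ => i.elim0

@[simp] theorem val_ofFun (g : ℝ → ℝ) (hg : SmoothBdd g) (φ : H) :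
    (ofFun g hg φ).val ξ ω = g (ξ φ ω) := rfl

@[simp] theorem grad_ofFun (g : ℝ → ℝ) (hg : SmoothBdd g) (φ : H) :
    (ofFun g hg φ).grad ξ ω = deriv g (ξ φ ω) • φ := by
  let L : (Fin 1 → ℝ) →L[ℝ] ℝ := ContinuousLinearMap.proj (R := ℝ) (φ := fun _ : Fin 1 => ℝ) 0
  have h1 : HasFDerivAt (fun p : Fin 1 → ℝ => g (p 0))
      (fderiv ℝ g (ξ φ ω) ∘L L) (fun _ => ξ φ ω) :=
    HasFDerivAt.comp (g := g) (f := L) (fun _ => ξ φ ω) (hg.differentiable _).hasFDerivAt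
      L.hasFDerivAt
  have h2 : (ofFun g hg φ).grad ξ ω = ∑ i : Fin 1,
      fderiv ℝ (fun p : Fin 1 → ℝ => g (p 0)) (fun _ => ξ φ ω) (Pi.single i 1) • φ := rfl
  rw [h2, h1.fderiv]
  simp [L]

theorem fstL_point : fstL F.n G.n (fun i => ξ (Fin.append F.dir G.dir i) ω) = F.point ξ ω := by
  ext i; simp [fstL, point]

theorem sndL_point : sndL F.n G.n (fun i => ξ (Fin.append F.dir G.dir i) ω) = G.point ξ ω := by
  ext i; simp [sndL, point]

@[simp] theorem val_add : (F.add G).val ξ ω = F.val ξ ω + G.val ξ ω := by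
  simp only [val]
  rw [← fstL_point ξ ω F G, ← sndL_point ξ ω F G]
  rfl

@[simp] theorem val_mul : (F.mul G).val ξ ω = F.val ξ ω * G.val ξ ω := by
  simp only [val]
  rw [← fstL_point ξ ω F G, ← sndL_point ξ ω F G]
  rfl

-- The two lists of directions are concatenated; each coordinate vector is killed by one of the two
-- block projections, so the sum splits. The product below works the same way.
@[simp] theorem grad_add : (F.add G).grad ξ ω = F.grad ξ ω + G.grad ξ ω := by
  set p : Fin (F.n + G.n) → ℝ := fun i => ξ (Fin.append F.dir G.dir i) ω with hp
  have h : HasFDerivAt (fun p => F.f (fstL F.n G.n p) + G.f (sndL F.n G.n p))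
      (fderiv ℝ F.f (F.point ξ ω) ∘L fstL F.n G.n + fderiv ℝ G.f (G.point ξ ω) ∘L sndL F.n G.n)
      p := by
    rw [← fstL_point ξ ω F G, ← sndL_point ξ ω F G]
    exact ((F.smoothBdd.differentiable _).hasFDerivAt.comp p (fstL F.n G.n).hasFDerivAt).add
      ((G.smoothBdd.differentiable _).hasFDerivAt.comp p (sndL F.n G.n).hasFDerivAt)
  have h2 : (F.add G).grad ξ ω = ∑ i : Fin (F.n + G.n),
      fderiv ℝ (fun p => F.f (fstL F.n G.n p) + G.f (sndL F.n G.n p)) p (Pi.single i 1) •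
        Fin.append F.dir G.dir i := rfl
  rw [h2, h.fderiv, Fin.sum_univ_add]
  simp [fstL_single_castAdd, fstL_single_natAdd, sndL_single_castAdd, sndL_single_natAdd, grad]

@[simp] theorem grad_mul :
    (F.mul G).grad ξ ω = F.val ξ ω • G.grad ξ ω + G.val ξ ω • F.grad ξ ω := by
  set p : Fin (F.n + G.n) → ℝ := fun i => ξ (Fin.append F.dir G.dir i) ω with hp
  have h : HasFDerivAt (fun p => F.f (fstL F.n G.n p) * G.f (sndL F.n G.n p))
      (F.f (F.point ξ ω) • (fderiv ℝ G.f (G.point ξ ω) ∘L sndL F.n G.n) +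
        G.f (G.point ξ ω) • (fderiv ℝ F.f (F.point ξ ω) ∘L fstL F.n G.n)) p := by
    rw [← fstL_point ξ ω F G, ← sndL_point ξ ω F G]
    exact ((F.smoothBdd.differentiable _).hasFDerivAt.comp p (fstL F.n G.n).hasFDerivAt).mul
      ((G.smoothBdd.differentiable _).hasFDerivAt.comp p (sndL F.n G.n).hasFDerivAt)
  have h2 : (F.mul G).grad ξ ω = ∑ i : Fin (F.n + G.n),
      fderiv ℝ (fun p => F.f (fstL F.n G.n p) * G.f (sndL F.n G.n p)) p (Pi.single i 1) •
        Fin.append F.dir G.dir i := rfl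
  rw [h2, h.fderiv, Fin.sum_univ_add, add_comm]
  simp [fstL_single_castAdd, fstL_single_natAdd, sndL_single_castAdd, sndL_single_natAdd, grad,
    val, Finset.smul_sum, smul_smul]

theorem map_eq_sum_single {n : ℕ} {E : Type*} [NormedAddCommGroup E] [NormedSpace ℝ E]
    (L : (Fin n → ℝ) →L[ℝ] E) (v : Fin n → ℝ) : L v = ∑ i, v i • L (Pi.single i 1) := by
  conv_lhs => rw [pi_eq_sum_univ' v]
  simp only [map_sum, map_smul]

@[simp] theorem val_dirDeriv (h : H) : (F.dirDeriv h).val ξ ω = ⟪F.grad ξ ω, h⟫ := by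
  have h2 : (F.dirDeriv h).val ξ ω = fderiv ℝ F.f (F.point ξ ω) fun i => ⟪F.dir i, h⟫ := rfl
  rw [h2, map_eq_sum_single, grad, sum_inner]
  simp only [real_inner_smul_left, smul_eq_mul]
  exact Finset.sum_congr rfl fun i _ => mul_comm _ _

/-- Second derivatives become first derivatives of another cylindrical variable, so first-order
estimates can be reused at second order. -/
theorem inner_grad_dirDeriv (h u : H) :
    ⟪(F.dirDeriv h).grad ξ ω, u⟫ = F.hess ξ ω u h := by
  set v : Fin F.n → ℝ := fun i => ⟪F.dir i, h⟫ with hv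
  have h1 : HasFDerivAt (fun p => fderiv ℝ F.f p v)
      (ContinuousLinearMap.apply ℝ ℝ v ∘L fderiv ℝ (fderiv ℝ F.f) (F.point ξ ω)) (F.point ξ ω) :=
    (ContinuousLinearMap.apply ℝ ℝ v).hasFDerivAt.comp _
      (F.smoothBdd.fderiv.differentiable _).hasFDerivAt
  have h2 : (F.dirDeriv h).grad ξ ω = ∑ i : Fin F.n,
      fderiv ℝ (fun p => fderiv ℝ F.f p v) (F.point ξ ω) (Pi.single i 1) • F.dir i := rfl
  rw [h2, h1.fderiv, sum_inner, hess]
  simp only [_root_.sum_apply, _root_.smul_apply,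
    ContinuousLinearMap.smulRight_apply, innerSL_apply_apply, real_inner_smul_left]
  refine Finset.sum_congr rfl fun i _ => ?_
  rw [ContinuousLinearMap.comp_apply, ContinuousLinearMap.apply_apply, map_eq_sum_single _ v,
    Finset.sum_mul]
  refine Finset.sum_congr rfl fun j _ => ?_
  simp only [hv, smul_eq_mul]
  ring

theorem hess_symm (u v : H) : F.hess ξ ω u v = F.hess ξ ω v u := by
  have hs : ∀ a b, fderiv ℝ (fderiv ℝ F.f) (F.point ξ ω) a b =
      fderiv ℝ (fderiv ℝ F.f) (F.point ξ ω) b a := fun a b =>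
    (F.contDiff.contDiffAt.isSymmSndFDerivAt
      (by simpa using WithTop.coe_le_coe.2 (le_top (a := (2 : ℕ∞))))) a b
  simp only [hess, _root_.sum_apply, _root_.smul_apply,
    ContinuousLinearMap.smulRight_apply, innerSL_apply_apply]
  rw [Finset.sum_comm]
  refine Finset.sum_congr rfl fun i _ => Finset.sum_congr rfl fun j _ => ?_
  rw [hs]
  simp only [smul_eq_mul]
  ring

theorem exists_abs_val_le : ∃ C, ∀ ω, |F.val ξ ω| ≤ C :=
  let ⟨C, hC⟩ := F.smoothBdd.exists_norm_le
  ⟨C, fun _ => hC _⟩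

theorem exists_norm_grad_le : ∃ C, ∀ ω, ‖F.grad ξ ω‖ ≤ C := by
  choose C hC using fun i => (F.smoothBdd.fderiv_apply (Pi.single i 1)).exists_norm_le
  refine ⟨∑ i, C i * ‖F.dir i‖, fun ω => (norm_sum_le _ _).trans (Finset.sum_le_sum fun i _ => ?_)⟩
  rw [norm_smul]
  gcongr
  exact hC i _

end Cylinder

end

section

/-! ### Gaussian integration by parts -/

theorem integrable_gaussianReal_iff {v : NNReal} (hv : v ≠ 0) (g : ℝ → ℝ) :
    Integrable g (gaussianReal 0 v) ↔ Integrable fun t => gaussianPDFReal 0 v t * g t := by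
  rw [gaussianReal_of_var_ne_zero 0 hv, integrable_withDensity_iff_integrable_smul'
    (measurable_gaussianPDF 0 v) (Eventually.of_forall fun _ => gaussianPDF_lt_top)]
  simp [toReal_gaussianPDF]

theorem hasDerivAt_gaussianPDFReal (v : NNReal) (t : ℝ) :
    HasDerivAt (gaussianPDFReal 0 v) (-(t / v) * gaussianPDFReal 0 v t) t := by
  have h : HasDerivAt (fun t : ℝ => -(t - 0) ^ 2 / (2 * v)) (-(t / v)) t := by
    refine ((((hasDerivAt_id t).sub_const 0).pow 2).neg.div_const (2 * (v : ℝ))).congr_deriv ?_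
    simp only [id_eq, sub_zero]
    rcases eq_or_ne (v : ℝ) 0 with hv | hv
    · simp [hv]
    · field_simp
      norm_num
  rw [gaussianPDFReal_def]
  refine (h.exp.const_mul _).congr_deriv ?_
  ring

/-- Stein's identity for the centred normal distribution. -/
theorem integral_mul_gaussianReal {v : NNReal} {g g' : ℝ → ℝ}
    (hg : ∀ t, HasDerivAt g (g' t) t) (hg' : Continuous g') {C C' : ℝ}
    (hC : ∀ t, |g t| ≤ C) (hC' : ∀ t, |g' t| ≤ C') :
    ∫ t, g t * t ∂gaussianReal 0 v = v * ∫ t, g' t ∂gaussianReal 0 v := by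
  rcases eq_or_ne v 0 with rfl | hv
  · simp
  have hgc : Continuous g := continuous_iff_continuousAt.2 fun t => (hg t).continuousAt
  have hid : Integrable (fun t : ℝ => t) (gaussianReal 0 v) :=
    (memLp_id_gaussianReal (μ := 0) (v := v) 1).integrable (by simp)
  have i1 : Integrable (fun t => g t * t) (gaussianReal 0 v) :=
    hid.bdd_mul hgc.aestronglyMeasurable (Eventually.of_forall hC)
  have i2 : Integrable g' (gaussianReal 0 v) :=
    Integrable.of_bound hg'.aestronglyMeasurable C' (Eventually.of_forall hC')
  have i3 : Integrable g (gaussianReal 0 v) :=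
    Integrable.of_bound hgc.aestronglyMeasurable C (Eventually.of_forall hC)
  rw [integrable_gaussianReal_iff hv] at i1 i2 i3
  -- The density ρ satisfies ρ' = -(t/v) ρ. Integrability of g t ρ, g' ρ and g ρ makes the boundary
  -- terms vanish.
  have key := integral_mul_deriv_eq_deriv_mul_of_integrable
    (u := g) (u' := g') (v := gaussianPDFReal 0 v)
    (v' := fun t => -(t / v) * gaussianPDFReal 0 v t)
    (fun t _ => hg t) (fun t _ => hasDerivAt_gaussianPDFReal v t)
    ((i1.const_mul (-(1 / (v : ℝ)))).congr (Eventually.of_forall fun t => by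
      simp only [Pi.mul_apply]; ring))
    (i2.congr (Eventually.of_forall fun t => by simp only [Pi.mul_apply]; ring))
    (i3.congr (Eventually.of_forall fun t => by simp only [Pi.mul_apply]; ring))
  rw [integral_gaussianReal_eq_integral_smul hv, integral_gaussianReal_eq_integral_smul hv]
  have e1 : ∫ t, g t * (-(t / v) * gaussianPDFReal 0 v t) =
      -(1 / (v : ℝ)) * ∫ t, gaussianPDFReal 0 v t • (g t * t) := by
    rw [← integral_const_mul]
    refine integral_congr_ae (Eventually.of_forall fun t => ?_)
    simp only [smul_eq_mul]; ring
  have e2 : ∫ t, g' t * gaussianPDFReal 0 v t = ∫ t, gaussianPDFReal 0 v t • g' t := by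
    refine integral_congr_ae (Eventually.of_forall fun t => ?_)
    simp only [smul_eq_mul]; ring
  rw [e1, e2] at key
  have hv' : (v : ℝ) ≠ 0 := by exact_mod_cast hv
  field_simp at key
  linarith

variable {H : Type*} [NormedAddCommGroup H] [InnerProductSpace ℝ H]
variable {Ω : Type*} [mΩ : MeasurableSpace Ω] {ξ : H → Ω → ℝ} {P : Measure Ω}

namespace IsIsonormal

variable (hξ : IsIsonormal ξ P)
include hξ

theorem memLp_two (φ : H) : MemLp (ξ φ) 2 P := (hξ.gaussian.hasGaussianLaw_eval φ).memLp_two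

theorem variance_eq (φ : H) : Var[ξ φ; P] = ‖φ‖ ^ 2 := by
  rw [(hξ.hasLaw φ).variance_eq, variance_id_gaussianReal]
  simp

theorem ae_eq_zero : ξ 0 =ᵐ[P] 0 := by
  filter_upwards [hξ.linear 0 0 0 0] with ω hω
  simpa using hω

/-- Polarization: by Pythagoras the variance of ξ(φ + ψ) is the sum of the two variances, which
leaves no room for a covariance. -/
theorem covariance_eq_zero {φ ψ : H} (h : ⟪φ, ψ⟫ = 0) : cov[ξ φ, ξ ψ; P] = 0 := by
  have := hξ.gaussian.isProbabilityMeasure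
  have h1 : ξ (φ + ψ) =ᵐ[P] ξ φ + ξ ψ := by
    have := hξ.linear 1 1 φ ψ
    simp only [one_smul, one_mul] at this
    exact this
  have h2 := variance_add (hξ.memLp_two φ) (hξ.memLp_two ψ)
  rw [← variance_congr h1, hξ.variance_eq, hξ.variance_eq, hξ.variance_eq, norm_add_sq_real, h]
    at h2
  linarith

/-- Uncorrelated jointly Gaussian families are independent. The single variable ξ k is treated as a
family over `Unit`. -/
theorem indepFun {ι : Type*} {k : H} {ψ : ι → H} (h : ∀ i, ⟪k, ψ i⟫ = 0) :
    IndepFun (ξ k) (fun ω i => ξ (ψ i) ω) P := by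
  have h1 : IsGaussianProcess (Sum.elim (fun _ : Unit => ξ k) fun i => ξ (ψ i)) P := by
    have e : Sum.elim (fun _ : Unit => ξ k) (fun i => ξ (ψ i)) =
        ξ ∘ Sum.elim (fun _ : Unit => k) ψ := by
      ext (i | i) <;> rfl
    rw [e]
    exact hξ.gaussian.comp_right (Sum.elim (fun _ : Unit => k) ψ)
  have h2 := h1.indepFun_of_covariance_eq_zero (fun _ => (hξ.measurable _).aemeasurable)
    (fun _ => (hξ.measurable _).aemeasurable) (fun _ i => hξ.covariance_eq_zero (h i))
  exact h2.comp (φ := fun p : Unit → ℝ => p ()) (ψ := id) (measurable_pi_apply _) measurable_id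

theorem integral_val_mul (F : Cylinder H) (k : H) :
    ∫ ω, F.val ξ ω * ξ k ω ∂P = ∫ ω, ⟪k, F.grad ξ ω⟫ ∂P := by
  have := hξ.gaussian.isProbabilityMeasure
  rcases eq_or_ne k 0 with rfl | hk
  · simp only [inner_zero_left, integral_zero]
    rw [← integral_zero Ω ℝ (μ := P)]
    refine integral_congr_ae ?_
    filter_upwards [hξ.ae_eq_zero] with ω hω
    simp [hω]
  have hk2 : ‖k‖ ^ 2 ≠ 0 := by positivity
  -- Orthogonal decomposition of each direction: c i is its coefficient along k, and ψ i the
  -- component orthogonal to k.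
  set c : Fin F.n → ℝ := fun i => ⟪F.dir i, k⟫ / ‖k‖ ^ 2 with hc
  set ψ : Fin F.n → H := fun i => F.dir i - c i • k with hψ
  have hind : IndepFun (fun ω i => ξ (ψ i) ω) (ξ k) P := by
    refine (hξ.indepFun fun i => ?_).symm
    rw [hψ, inner_sub_right, real_inner_smul_right, real_inner_self_eq_norm_sq, hc,
      div_mul_cancel₀ _ hk2, real_inner_comm, sub_self]
  have hpt : ∀ᵐ ω ∂P, F.point ξ ω = ξ k ω • c + fun i => ξ (ψ i) ω := by
    have : ∀ᵐ ω ∂P, ∀ i, ξ (F.dir i) ω = c i * ξ k ω + ξ (ψ i) ω := by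
      refine ae_all_iff.2 fun i => ?_
      filter_upwards [hξ.linear (c i) 1 k (ψ i)] with ω hω
      simpa [hψ] using hω
    filter_upwards [this] with ω hω
    ext i
    simp [Cylinder.point, hω, mul_comm]
  have hYm : Measurable fun ω i => ξ (ψ i) ω := measurable_pi_lambda _ fun i => hξ.measurable _
  have hmap := (indepFun_iff_map_prod_eq_prod_map_map hYm.aemeasurable
    (hξ.measurable k).aemeasurable).1 hind
  rw [(hξ.hasLaw k).map_eq] at hmap
  have hpm : Measurable fun ω => ((fun i => ξ (ψ i) ω), ξ k ω) := hYm.prodMk (hξ.measurable k)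
  have := Measure.isProbabilityMeasure_map (μ := P) hYm.aemeasurable
  set Q := P.map fun ω i => ξ (ψ i) ω
  set γ := gaussianReal 0 (‖k‖₊ ^ 2)
  obtain ⟨C, hC⟩ := F.smoothBdd.exists_norm_le
  obtain ⟨C', hC'⟩ := (F.smoothBdd.fderiv_apply c).exists_norm_le
  have hfc : Continuous F.f := F.contDiff.continuous
  have hf'c : Continuous fun p => fderiv ℝ F.f p c :=
    (F.smoothBdd.fderiv_apply c).contDiff.continuous
  have hid : Integrable (fun q : (Fin F.n → ℝ) × ℝ => q.2) (Q.prod γ) :=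
    ((memLp_id_gaussianReal (μ := 0) (v := ‖k‖₊ ^ 2) 1).integrable (by simp)).comp_snd Q
  have i1 : Integrable (fun q : (Fin F.n → ℝ) × ℝ => F.f (q.2 • c + q.1) * q.2) (Q.prod γ) :=
    hid.bdd_mul (by fun_prop : Continuous fun q : (Fin F.n → ℝ) × ℝ =>
      F.f (q.2 • c + q.1)).aestronglyMeasurable (Eventually.of_forall fun q => hC _)
  have hc1 : Continuous fun q : (Fin F.n → ℝ) × ℝ => fderiv ℝ F.f (q.2 • c + q.1) c :=
    hf'c.comp (by fun_prop)
  have i2 : Integrable (fun q : (Fin F.n → ℝ) × ℝ => fderiv ℝ F.f (q.2 • c + q.1) c)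
      (Q.prod γ) :=
    Integrable.of_bound hc1.aestronglyMeasurable C' (Eventually.of_forall fun q => hC' _)
  have e1 : ∫ ω, F.val ξ ω * ξ k ω ∂P = ∫ q, F.f (q.2 • c + q.1) * q.2 ∂(Q.prod γ) := by
    rw [← hmap, integral_map hpm.aemeasurable (hmap ▸ i1.aestronglyMeasurable)]
    refine integral_congr_ae ?_
    filter_upwards [hpt] with ω hω
    simp [Cylinder.val, hω]
  have e2 : ∫ ω, ⟪k, F.grad ξ ω⟫ ∂P =
      ‖k‖ ^ 2 * ∫ q, fderiv ℝ F.f (q.2 • c + q.1) c ∂(Q.prod γ) := by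
    rw [← hmap, integral_map hpm.aemeasurable (hmap ▸ i2.aestronglyMeasurable),
      ← integral_const_mul]
    refine integral_congr_ae ?_
    filter_upwards [hpt] with ω hω
    have hck : (fun i => ⟪F.dir i, k⟫) = ‖k‖ ^ 2 • c := by
      ext i
      simp only [hc, Pi.smul_apply, smul_eq_mul]
      field_simp
    rw [real_inner_comm, ← Cylinder.val_dirDeriv, ← smul_eq_mul, ← map_smul, ← hω, ← hck]
    rfl
  rw [e1, e2, integral_prod _ i1, integral_prod _ i2, ← integral_const_mul]
  -- With the orthogonal coordinates frozen at y, Stein's identity applies to t ↦ f(t c + y); its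
  -- variance ‖k‖² cancels the denominator of c.
  refine integral_congr_ae (Eventually.of_forall fun y => ?_)
  have hd : ∀ t : ℝ, HasDerivAt (fun t : ℝ => F.f (t • c + y))
      (fderiv ℝ F.f (t • c + y) c) t := fun t => by
    have h1 : HasDerivAt (fun t : ℝ => t • c + y) c t := by
      simpa using ((hasDerivAt_id t).smul_const c).add_const y
    exact (F.smoothBdd.differentiable _).hasFDerivAt.comp_hasDerivAt t h1
  have := integral_mul_gaussianReal (v := ‖k‖₊ ^ 2) hd (hf'c.comp (by fun_prop)) (fun t => hC _)
    (fun t => hC' _)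
  simpa using this

end IsIsonormal

end

/-! ### Convergence in mean square -/

section TendstoL2

variable {Ω : Type*} [mΩ : MeasurableSpace Ω] {P : Measure Ω}
variable {E F : Type*} [NormedAddCommGroup E] [NormedAddCommGroup F]

/-- Convergence in mean square. -/
def TendstoL2 (P : Measure Ω) (u : ℕ → Ω → E) (v : Ω → E) : Prop :=
  Tendsto (fun n => eLpNorm (fun ω => u n ω - v ω) 2 P) atTop (𝓝 0)

theorem eLpNorm_two_sq (f : Ω → E) : eLpNorm f 2 P ^ 2 = ∫⁻ ω, ‖f ω‖ₑ ^ 2 ∂P := by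
  have := eLpNorm_nnreal_pow_eq_lintegral (f := f) (p := 2) (μ := P) (by simp)
  simpa using this

theorem tendsto_zero_of_sq_tendsto_zero {a : ℕ → ℝ≥0∞}
    (h : Tendsto (fun n => a n ^ 2) atTop (𝓝 0)) : Tendsto a atTop (𝓝 0) := by
  have := (ENNReal.continuous_rpow_const (y := 1 / 2)).tendsto 0 |>.comp h
  rw [ENNReal.zero_rpow_of_pos (by norm_num)] at this
  refine this.congr fun n => ?_
  rw [Function.comp_apply, ← ENNReal.rpow_natCast, ← ENNReal.rpow_mul]
  norm_num

theorem tendstoL2_iff {u : ℕ → Ω → E} {v : Ω → E} :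
    TendstoL2 P u v ↔ Tendsto (fun n => ∫⁻ ω, ‖u n ω - v ω‖ₑ ^ 2 ∂P) atTop (𝓝 0) := by
  simp_rw [← eLpNorm_two_sq]
  refine ⟨fun h => ?_, tendsto_zero_of_sq_tendsto_zero⟩
  simpa using ENNReal.Tendsto.pow (n := 2) h

namespace TendstoL2

theorem of_norm_le {u : ℕ → Ω → E} {v : Ω → E} {u' : ℕ → Ω → F} {v' : Ω → F}
    (h : TendstoL2 P u v) (C : ℝ)
    (hC : ∀ n ω, ‖u' n ω - v' ω‖ ≤ C * ‖u n ω - v ω‖) : TendstoL2 P u' v' := by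
  have h1 : Tendsto (fun n => ENNReal.ofReal C * eLpNorm (fun ω => u n ω - v ω) 2 P) atTop
      (𝓝 0) := by
    simpa using ENNReal.Tendsto.const_mul h (Or.inr ENNReal.ofReal_ne_top)
  exact tendsto_of_tendsto_of_tendsto_of_le_of_le tendsto_const_nhds h1 (fun _ => zero_le)
    fun n => eLpNorm_le_mul_eLpNorm_of_ae_le_mul (Eventually.of_forall (hC n)) 2

theorem const (v : Ω → E) : TendstoL2 P (fun _ => v) v := by
  simp [TendstoL2]

theorem add {u u' : ℕ → Ω → E} {v v' : Ω → E}
    (hu : ∀ n, AEStronglyMeasurable (u n) P) (hv : AEStronglyMeasurable v P)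
    (hu' : ∀ n, AEStronglyMeasurable (u' n) P) (hv' : AEStronglyMeasurable v' P)
    (h : TendstoL2 P u v) (h' : TendstoL2 P u' v') :
    TendstoL2 P (fun n ω => u n ω + u' n ω) (fun ω => v ω + v' ω) := by
  have h1 : Tendsto (fun n => eLpNorm (fun ω => u n ω - v ω) 2 P +
      eLpNorm (fun ω => u' n ω - v' ω) 2 P) atTop (𝓝 0) := by
    simpa using Tendsto.add h h'
  refine tendsto_of_tendsto_of_tendsto_of_le_of_le tendsto_const_nhds h1 (fun _ => zero_le)
    fun n => ?_
  refine le_trans (le_of_eq ?_) (eLpNorm_add_le ((hu n).sub hv) ((hu' n).sub hv') (by norm_num))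
  congr 1
  ext ω
  simp only [Pi.add_apply]
  abel

theorem neg {u : ℕ → Ω → E} {v : Ω → E} (h : TendstoL2 P u v) :
    TendstoL2 P (fun n ω => -u n ω) (fun ω => -v ω) :=
  h.of_norm_le 1 fun n ω => by rw [neg_sub_neg, norm_sub_rev, one_mul]

/-- The classes measurable for a sub-σ-algebra form a closed subset of L². This puts integrals and
derivatives, obtained as limits, in σ(ξ). -/
theorem aestronglyMeasurable [CompleteSpace E] {u : ℕ → Ω → E} {v : Ω → E} (h : TendstoL2 P u v)
    (hu : ∀ n, MemLp (u n) 2 P) (hv : MemLp v 2 P) {m : MeasurableSpace Ω} (hm : m ≤ mΩ)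
    (hum : ∀ n, AEStronglyMeasurable[m] (u n) P) : AEStronglyMeasurable[m] v P := by
  have h1 := (Lp.tendsto_Lp_iff_tendsto_eLpNorm'' u hu v hv).2 h
  have h2 := (isClosed_aestronglyMeasurable (F := E) (p := 2) (μ := P) hm).mem_of_tendsto h1
    (Eventually.of_forall fun n => (hum n).congr (hu n).coeFn_toLp.symm)
  exact AEStronglyMeasurable.congr h2 hv.coeFn_toLp

theorem of_dominated {u : ℕ → Ω → E} {v : Ω → E} {g : Ω → ℝ} (hg : MemLp g 2 P)
    (hu : ∀ n, AEStronglyMeasurable (u n) P) (hv : AEStronglyMeasurable v P)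
    (hle : ∀ n ω, ‖u n ω - v ω‖ ≤ g ω)
    (hlim : ∀ ω, Tendsto (fun n => u n ω) atTop (𝓝 (v ω))) : TendstoL2 P u v := by
  rw [tendstoL2_iff]
  have hz : ∫⁻ _ : Ω, (0 : ℝ≥0∞) ∂P = 0 := lintegral_zero
  rw [← hz]
  refine tendsto_lintegral_of_dominated_convergence' (fun ω => ‖g ω‖ₑ ^ 2)
    (fun n => ((hu n).sub hv).enorm.pow_const 2) (fun n => Eventually.of_forall fun ω => ?_) ?_
    (Eventually.of_forall fun ω => ?_)
  · have : ‖u n ω - v ω‖ₑ ≤ ‖g ω‖ₑ :=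
      enorm_le_iff_norm_le.2 ((hle n ω).trans (le_abs_self _))
    exact pow_le_pow_left' this 2
  · rw [← eLpNorm_two_sq]
    exact ENNReal.pow_ne_top hg.2.ne
  · have h0 : Tendsto (fun n => u n ω - v ω) atTop (𝓝 0) := by
      simpa using (hlim ω).sub_const (v ω)
    have := ENNReal.Tendsto.pow (n := 2) h0.enorm
    simpa using this

theorem memLp {u : ℕ → Ω → E} {v : Ω → E} (hu : ∀ n, MemLp (u n) 2 P)
    (hv : AEStronglyMeasurable v P) (h : TendstoL2 P u v) : MemLp v 2 P := by
  obtain ⟨n, hn⟩ := (h.eventually (gt_mem_nhds ENNReal.zero_lt_top)).exists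
  have h1 : MemLp (fun ω => u n ω - v ω) 2 P := ⟨(hu n).1.sub hv, hn⟩
  refine ((hu n).sub h1).ae_eq (Eventually.of_forall fun ω => ?_)
  simp

theorem integral_inner [InnerProductSpace ℝ E] {u u' : ℕ → Ω → E} {v v' : Ω → E}
    (hu : ∀ n, MemLp (u n) 2 P) (hv : MemLp v 2 P) (hu' : ∀ n, MemLp (u' n) 2 P)
    (hv' : MemLp v' 2 P) (h : TendstoL2 P u v) (h' : TendstoL2 P u' v') :
    Tendsto (fun n => ∫ ω, ⟪u n ω, u' n ω⟫ ∂P) atTop (𝓝 (∫ ω, ⟪v ω, v' ω⟫ ∂P)) := by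
  have h1 := (Lp.tendsto_Lp_iff_tendsto_eLpNorm'' u hu v hv).2 h
  have h2 := (Lp.tendsto_Lp_iff_tendsto_eLpNorm'' u' hu' v' hv').2 h'
  have key : ∀ {a b : Ω → E} (ha : MemLp a 2 P) (hb : MemLp b 2 P),
      ⟪ha.toLp a, hb.toLp b⟫ = ∫ ω, ⟪a ω, b ω⟫ ∂P := fun ha hb => by
    rw [L2.inner_def]
    refine integral_congr_ae ?_
    filter_upwards [ha.coeFn_toLp, hb.coeFn_toLp] with ω h1 h2
    rw [h1, h2]
  simpa only [key] using Filter.Tendsto.inner (𝕜 := ℝ) h1 h2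

theorem integral_mul {u u' : ℕ → Ω → ℝ} {v v' : Ω → ℝ}
    (hu : ∀ n, MemLp (u n) 2 P) (hv : MemLp v 2 P) (hu' : ∀ n, MemLp (u' n) 2 P)
    (hv' : MemLp v' 2 P) (h : TendstoL2 P u v) (h' : TendstoL2 P u' v') :
    Tendsto (fun n => ∫ ω, u n ω * u' n ω ∂P) atTop (𝓝 (∫ ω, v ω * v' ω ∂P)) := by
  have := integral_inner hu' hv' hu hv h' h
  simpa using this

end TendstoL2

/-- Completeness of the space of square integrable random elements. -/
theorem exists_tendstoL2 [CompleteSpace E] {u : ℕ → Ω → E} (hu : ∀ n, MemLp (u n) 2 P)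
    (h : Tendsto (fun n : ℕ × ℕ => ∫⁻ ω, ‖u n.1 ω - u n.2 ω‖ₑ ^ 2 ∂P) atTop (𝓝 0)) :
    ∃ v, MemLp v 2 P ∧ TendstoL2 P u v := by
  have hc : CauchySeq fun n => (hu n).toLp (u n) := by
    rw [Lp.cauchySeq_Lp_iff_cauchySeq_eLpNorm]
    simp_rw [← eLpNorm_two_sq] at h
    have h2 : Tendsto (fun n : ℕ × ℕ => eLpNorm (fun ω => u n.1 ω - u n.2 ω) 2 P) atTop
        (𝓝 0) := by
      have := (ENNReal.continuous_rpow_const (y := 1 / 2)).tendsto 0 |>.comp h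
      rw [ENNReal.zero_rpow_of_pos (by norm_num)] at this
      refine this.congr fun n => ?_
      rw [Function.comp_apply, ← ENNReal.rpow_natCast, ← ENNReal.rpow_mul]
      norm_num
    refine h2.congr fun n => eLpNorm_congr_ae ?_
    filter_upwards [(hu n.1).coeFn_toLp, (hu n.2).coeFn_toLp] with ω h3 h4
    simp [h3, h4]
  obtain ⟨v, hv⟩ := cauchySeq_tendsto_of_complete hc
  refine ⟨v, Lp.memLp v, ?_⟩
  rw [← Lp.toLp_coeFn v (Lp.memLp v)] at hv
  exact (Lp.tendsto_Lp_iff_tendsto_eLpNorm'' u hu v (Lp.memLp v)).1 hv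

end TendstoL2

/-! ### The σ-algebra of an isonormal process -/

variable {H : Type*} [NormedAddCommGroup H] [InnerProductSpace ℝ H]
variable {Ω : Type*} [mΩ : MeasurableSpace Ω] {ξ : H → Ω → ℝ} {P : Measure Ω}

theorem measurable_sigmaAlgebra (ξ : H → Ω → ℝ) (φ : H) : Measurable[sigmaAlgebra ξ] (ξ φ) :=
  Measurable.mono (comap_measurable (ξ φ))
    (le_iSup (fun φ => MeasurableSpace.comap (ξ φ) inferInstance) φ) le_rfl

theorem sigmaAlgebra_eq_comap (ξ : H → Ω → ℝ) :
    sigmaAlgebra ξ = MeasurableSpace.comap (fun ω φ => ξ φ ω) MeasurableSpace.pi := by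
  simp only [sigmaAlgebra, MeasurableSpace.pi, MeasurableSpace.comap_iSup,
    MeasurableSpace.comap_comp]
  rfl

namespace Cylinder

variable (F : Cylinder H)

theorem measurable_point (ξ : H → Ω → ℝ) : Measurable[sigmaAlgebra ξ] (F.point ξ) :=
  @measurable_pi_lambda _ _ _ (sigmaAlgebra ξ) _ _ fun _ => measurable_sigmaAlgebra ξ _

theorem stronglyMeasurable_val (ξ : H → Ω → ℝ) : StronglyMeasurable[sigmaAlgebra ξ] (F.val ξ) :=
  F.contDiff.continuous.stronglyMeasurable.comp_measurable (F.measurable_point ξ)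

theorem stronglyMeasurable_grad (ξ : H → Ω → ℝ) :
    StronglyMeasurable[sigmaAlgebra ξ] (F.grad ξ) := by
  have h : ∀ i ∈ Finset.univ, StronglyMeasurable[sigmaAlgebra ξ]
      fun ω => fderiv ℝ F.f (F.point ξ ω) (Pi.single i 1) • F.dir i := fun i _ =>
    StronglyMeasurable.smul_const ((F.smoothBdd.fderiv_apply
      (Pi.single i 1)).contDiff.continuous.stronglyMeasurable.comp_measurable
        (F.measurable_point ξ)) _
  exact Finset.stronglyMeasurable_fun_sum Finset.univ h

end Cylinder

namespace IsIsonormal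

variable (hξ : IsIsonormal ξ P)
include hξ

theorem sigmaAlgebra_le : sigmaAlgebra ξ ≤ mΩ :=
  iSup_le fun φ => (hξ.measurable φ).comap_le

theorem memLp_val (F : Cylinder H) : MemLp (F.val ξ) 2 P := by
  have := hξ.gaussian.isProbabilityMeasure
  obtain ⟨C, hC⟩ := F.exists_abs_val_le ξ
  exact MemLp.of_bound ((F.stronglyMeasurable_val ξ).mono hξ.sigmaAlgebra_le).aestronglyMeasurable
    C (Eventually.of_forall hC)

theorem memLp_grad (F : Cylinder H) : MemLp (F.grad ξ) 2 P := by
  have := hξ.gaussian.isProbabilityMeasure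
  obtain ⟨C, hC⟩ := F.exists_norm_grad_le ξ
  exact MemLp.of_bound ((F.stronglyMeasurable_grad ξ).mono hξ.sigmaAlgebra_le).aestronglyMeasurable
    C (Eventually.of_forall hC)

end IsIsonormal

/-! ### Cylindrical random variables separate integrable random variables -/

/-- The real and imaginary parts of exp(i (φ, ξ)) are cylindrical variables. -/
theorem integral_mul_cexp_eq_zero {η : Ω → ℝ} (hξ : IsIsonormal ξ P) (hη : Integrable η P)
    (h : ∀ F : Cylinder H, ∫ ω, η ω * F.val ξ ω ∂P = 0) (φ : H) :
    ∫ ω, (η ω : ℂ) * Complex.exp (ξ φ ω * Complex.I) ∂P = 0 := by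
  have hc := h (Cylinder.ofFun _ SmoothBdd.cos φ)
  have hs := h (Cylinder.ofFun _ SmoothBdd.sin φ)
  simp only [Cylinder.val_ofFun] at hc hs
  have ic : Integrable (fun ω => η ω * Real.cos (ξ φ ω)) P :=
    hη.mul_bdd (Real.measurable_cos.comp (hξ.measurable φ)).aestronglyMeasurable
      (Eventually.of_forall fun ω => Real.abs_cos_le_one _)
  have is : Integrable (fun ω => η ω * Real.sin (ξ φ ω)) P :=
    hη.mul_bdd (Real.measurable_sin.comp (hξ.measurable φ)).aestronglyMeasurable
      (Eventually.of_forall fun ω => Real.abs_sin_le_one _)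
  have e : ∀ ω, (η ω : ℂ) * Complex.exp (ξ φ ω * Complex.I) =
      ((η ω * Real.cos (ξ φ ω) : ℝ) : ℂ) + ((η ω * Real.sin (ξ φ ω) : ℝ) : ℂ) * Complex.I := by
    intro ω
    rw [Complex.exp_mul_I]
    push_cast
    ring
  simp_rw [e]
  rw [integral_add ic.ofReal (is.ofReal.mul_const _), integral_mul_const, integral_complex_ofReal,
    integral_complex_ofReal, hc, hs]
  simp

/-- Any linear functional of finitely many coordinates is almost surely one coordinate, so the
characters above cover all finite-dimensional Fourier transforms. -/
theorem exists_ae_eq_sum (hξ : IsIsonormal ξ P) (I : Finset H) (c : H → ℝ) :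
    (fun ω => ∑ i ∈ I, c i * ξ i ω) =ᵐ[P] ξ (∑ i ∈ I, c i • i) := by
  classical
  induction I using Finset.induction_on with
  | empty =>
    filter_upwards [hξ.ae_eq_zero] with ω hω
    simp [hω]
  | insert a s ha ih =>
    filter_upwards [ih, hξ.linear (c a) 1 a (∑ i ∈ s, c i • i)] with ω h1 h2
    rw [Finset.sum_insert ha, h1, Finset.sum_insert ha]
    simpa using h2.symm

/-- The positive and negative parts of η are densities of two finite measures. Their images under ω
↦ (ξ φ ω)_φ have equal characteristic functions on every finite set of coordinates, so they agree on
the product space by uniqueness of projective limits. Hence η integrates to zero over every set of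
σ(ξ). -/
theorem ae_eq_zero_of_forall_integral_mul_val {η : Ω → ℝ} (hξ : IsIsonormal ξ P)
    (hη : Integrable η P) (hm : AEStronglyMeasurable[sigmaAlgebra ξ] η P)
    (h : ∀ F : Cylinder H, ∫ ω, η ω * F.val ξ ω ∂P = 0) : η =ᵐ[P] 0 := by
  classical
  have := hξ.gaussian.isProbabilityMeasure
  set X : Ω → H → ℝ := fun ω φ => ξ φ ω with hX
  have hXm : Measurable X := measurable_pi_lambda _ hξ.measurable
  have hηm := hη.aestronglyMeasurable.aemeasurable
  set μ₁ := P.withDensity fun ω => ENNReal.ofReal (η ω) with hμ₁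
  set μ₂ := P.withDensity fun ω => ENNReal.ofReal (-η ω) with hμ₂
  have : IsFiniteMeasure μ₁ := isFiniteMeasure_withDensity_ofReal hη.hasFiniteIntegral
  have : IsFiniteMeasure μ₂ := isFiniteMeasure_withDensity_ofReal hη.neg.hasFiniteIntegral
  have hfin : ∀ I : Finset H, (μ₁.map X).map I.restrict = (μ₂.map X).map I.restrict := fun I => by
    have hr : Measurable (I.restrict : (H → ℝ) → (I → ℝ)) := Finset.measurable_restrict I
    rw [Measure.map_map hr hXm, Measure.map_map hr hXm]
    refine Measure.ext_of_charFunDual (funext fun L => ?_)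
    have hcont : Continuous fun x : I → ℝ => Complex.exp (L x * Complex.I) := by fun_prop
    rw [charFunDual_apply, charFunDual_apply,
      integral_map (hr.comp hXm).aemeasurable hcont.aestronglyMeasurable,
      integral_map (hr.comp hXm).aemeasurable hcont.aestronglyMeasurable,
      integral_withDensity_eq_integral_toReal_smul₀ hηm.ennreal_ofReal (by simp),
      integral_withDensity_eq_integral_toReal_smul₀ (f := fun ω => ENNReal.ofReal (-η ω))
        hηm.neg.ennreal_ofReal (by simp),
      ← sub_eq_zero]
    have hb : ∀ᵐ ω ∂P, ‖Complex.exp (L ((I.restrict ∘ X) ω) * Complex.I)‖ ≤ 1 :=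
      Eventually.of_forall fun ω => by rw [Complex.norm_exp_ofReal_mul_I]
    have hbm : AEStronglyMeasurable
        (fun ω => Complex.exp (L ((I.restrict ∘ X) ω) * Complex.I)) P :=
      (hcont.measurable.comp (hr.comp hXm)).aestronglyMeasurable
    have i1 := (hη.real_toNNReal.ofReal (𝕜 := ℂ)).mul_bdd hbm hb
    have i2 := (hη.neg.real_toNNReal.ofReal (𝕜 := ℂ)).mul_bdd hbm hb
    -- The coefficients of L, extended by zero so that they are indexed by all of H.
    set c : H → ℝ := fun φ => if hφ : φ ∈ I then L (Pi.single ⟨φ, hφ⟩ 1) else 0 with hc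
    have hL : ∀ ω, L ((I.restrict ∘ X) ω) = ∑ i ∈ I, c i * ξ i ω := fun ω => by
      conv_lhs => rw [pi_eq_sum_univ' ((I.restrict ∘ X) ω)]
      rw [← Finset.sum_coe_sort I, map_sum]
      refine Finset.sum_congr rfl fun i _ => ?_
      rw [map_smul, smul_eq_mul, mul_comm, hc]
      simp [hX]
    rw [← integral_mul_cexp_eq_zero hξ hη h (∑ i ∈ I, c i • i)]
    simp only [Complex.real_smul]
    refine Eq.trans (integral_sub i1 i2).symm (integral_congr_ae ?_)
    filter_upwards [exists_ae_eq_sum hξ I c] with ω hω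
    rw [hL ω, ← hω]
    have hη' : max (η ω) 0 - max (-η ω) 0 = η ω := by
      rcases le_total 0 (η ω) with h | h <;> simp [h]
    rw [← sub_mul]
    congr 1
    simp only [Pi.neg_apply, Complex.coe_algebraMap, ← Complex.ofReal_sub, Real.coe_toNNReal']
    exact_mod_cast hη'
  have hmap : μ₁.map X = μ₂.map X :=
    IsProjectiveLimit.unique (P := fun I => (μ₁.map X).map I.restrict) (fun I => rfl)
      (fun I => (hfin I).symm)
  refine ae_eq_of_forall_setIntegral_eq_of_sigmaFinite' hξ.sigmaAlgebra_le
    (fun s _ _ => hη.integrableOn) (fun s _ _ => (integrable_zero _ _ _).integrableOn)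
    (fun s hs _ => ?_) hm (stronglyMeasurable_zero.aestronglyMeasurable)
  have hs' := hξ.sigmaAlgebra_le s hs
  rw [sigmaAlgebra_eq_comap] at hs
  obtain ⟨t, ht, rfl⟩ := hs
  have h1 : μ₁ (X ⁻¹' t) = μ₂ (X ⁻¹' t) := by
    rw [← Measure.map_apply hXm ht, hmap, Measure.map_apply hXm ht]
  rw [withDensity_apply _ hs', withDensity_apply _ hs'] at h1
  rw [integral_eq_lintegral_pos_part_sub_lintegral_neg_part hη.integrableOn, h1]
  simp

/-! ### Stochastically differentiable random variables -/

theorem memLp_bdd_smul {E : Type*} [NormedAddCommGroup E] [NormedSpace ℝ E] {u : Ω → E}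
    {c : Ω → ℝ} (hu : MemLp u 2 P) (hc : AEStronglyMeasurable c P) {C : ℝ}
    (hC : ∀ᵐ ω ∂P, |c ω| ≤ C) : MemLp (fun ω => c ω • u ω) 2 P := by
  refine hu.of_le_mul (c := C) (hc.smul hu.1) ?_
  filter_upwards [hC] with ω hω
  rw [norm_smul]
  gcongr
  exact hω

theorem integrable_inner_of_memLp {E : Type*} [NormedAddCommGroup E] [InnerProductSpace ℝ E]
    {u v : Ω → E} (hu : MemLp u 2 P) (hv : MemLp v 2 P) : Integrable (fun ω => ⟪u ω, v ω⟫) P := by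
  refine (L2.integrable_inner (𝕜 := ℝ) (hu.toLp u) (hv.toLp v)).congr ?_
  filter_upwards [hu.coeFn_toLp, hv.coeFn_toLp] with ω h1 h2
  rw [h1, h2]

theorem Cylinder.val_dirDeriv_eq (F : Cylinder H) (h : H) :
    (F.dirDeriv h).val ξ = fun ω => ⟪F.grad ξ ω, h⟫ :=
  funext fun ω => F.val_dirDeriv ξ ω h

theorem IsIsonormal.hasStochDeriv_cylinder (hξ : IsIsonormal ξ P) (F : Cylinder H) :
    HasStochDeriv ξ P (F.val ξ) (F.grad ξ) :=
  ⟨hξ.memLp_val F, hξ.memLp_grad F, fun _ => F, TendstoL2.const _, TendstoL2.const _⟩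

namespace HasStochDeriv

variable {α β : Ω → ℝ} {Dα Dβ : Ω → H}

theorem congr (h : HasStochDeriv ξ P α Dα) (h1 : α =ᵐ[P] β) (h2 : Dα =ᵐ[P] Dβ) :
    HasStochDeriv ξ P β Dβ := by
  obtain ⟨m1, m2, F, t1, t2⟩ := h
  refine ⟨m1.ae_eq h1, m2.ae_eq h2, F, t1.congr fun n => ?_, t2.congr fun n => ?_⟩
  · refine eLpNorm_congr_ae ?_
    filter_upwards [h1] with ω hω
    rw [hω]
  · refine eLpNorm_congr_ae ?_
    filter_upwards [h2] with ω hω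
    rw [hω]

/-- Diagonal argument: approximate the n-th pair by a cylindrical one within 1/(n + 1). -/
theorem of_tendsto (hξ : IsIsonormal ξ P) {a : ℕ → Ω → ℝ} {Da : ℕ → Ω → H}
    (h : ∀ n, HasStochDeriv ξ P (a n) (Da n)) (hα : MemLp α 2 P) (hDα : MemLp Dα 2 P)
    (h1 : TendstoL2 P a α) (h2 : TendstoL2 P Da Dα) : HasStochDeriv ξ P α Dα := by
  have hex : ∀ n : ℕ, ∃ F : Cylinder H,
      eLpNorm (fun ω => F.val ξ ω - a n ω) 2 P ≤ (n + 1 : ℝ≥0∞)⁻¹ ∧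
      eLpNorm (fun ω => F.grad ξ ω - Da n ω) 2 P ≤ (n + 1 : ℝ≥0∞)⁻¹ := fun n => by
    obtain ⟨-, -, F, t1, t2⟩ := h n
    have hpos : (0 : ℝ≥0∞) < (n + 1 : ℝ≥0∞)⁻¹ := ENNReal.inv_pos.2 (by finiteness)
    obtain ⟨k, hk1, hk2⟩ := ((t1.eventually (gt_mem_nhds hpos)).and
      (t2.eventually (gt_mem_nhds hpos))).exists
    exact ⟨F k, hk1.le, hk2.le⟩
  choose F hF1 hF2 using hex
  have hz : Tendsto (fun n : ℕ => (n + 1 : ℝ≥0∞)⁻¹) atTop (𝓝 0) := by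
    have := (tendsto_add_atTop_iff_nat 1).2 ENNReal.tendsto_inv_nat_nhds_zero
    simpa using this
  refine ⟨hα, hDα, F, ?_, ?_⟩
  · have ht := hz.add h1
    rw [add_zero] at ht
    refine tendsto_of_tendsto_of_tendsto_of_le_of_le tendsto_const_nhds ht (fun _ => zero_le)
      fun n => ?_
    refine le_trans (le_of_eq ?_) ((eLpNorm_add_le ((hξ.memLp_val (F n)).1.sub (h n).1.1)
      ((h n).1.1.sub hα.1) (by norm_num)).trans (add_le_add (hF1 n) le_rfl))
    congr 1
    ext ω
    simp
  · have ht := hz.add h2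
    rw [add_zero] at ht
    refine tendsto_of_tendsto_of_tendsto_of_le_of_le tendsto_const_nhds ht (fun _ => zero_le)
      fun n => ?_
    refine le_trans (le_of_eq ?_) ((eLpNorm_add_le ((hξ.memLp_grad (F n)).1.sub (h n).2.1.1)
      ((h n).2.1.1.sub hDα.1) (by norm_num)).trans (add_le_add (hF2 n) le_rfl))
    congr 1
    ext ω
    simp

theorem add (hξ : IsIsonormal ξ P) (hα : HasStochDeriv ξ P α Dα) (hβ : HasStochDeriv ξ P β Dβ) :
    HasStochDeriv ξ P (fun ω => α ω + β ω) (fun ω => Dα ω + Dβ ω) := by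
  obtain ⟨m1, m2, F, t1, t2⟩ := hα
  obtain ⟨n1, n2, G, s1, s2⟩ := hβ
  refine ⟨m1.add n1, m2.add n2, fun n => (F n).add (G n), ?_, ?_⟩
  · simp only [Cylinder.val_add]
    exact TendstoL2.add (fun n => (hξ.memLp_val _).1) m1.1 (fun n => (hξ.memLp_val _).1) n1.1
      t1 s1
  · simp only [Cylinder.grad_add]
    exact TendstoL2.add (fun n => (hξ.memLp_grad _).1) m2.1 (fun n => (hξ.memLp_grad _).1) n2.1
      t2 s2

/-- Multiplication by the bounded G and DG is continuous in L², so the Leibniz rule passes to the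
limit even for unbounded α. -/
theorem mul_cylinder (hξ : IsIsonormal ξ P) (hα : HasStochDeriv ξ P α Dα) (G : Cylinder H) :
    HasStochDeriv ξ P (fun ω => G.val ξ ω * α ω)
      (fun ω => G.val ξ ω • Dα ω + α ω • G.grad ξ ω) := by
  obtain ⟨C, hC⟩ := G.exists_abs_val_le ξ
  obtain ⟨C', hC'⟩ := G.exists_norm_grad_le ξ
  have hGm := (hξ.memLp_val G).1
  have key : ∀ {β : Ω → ℝ} {Dβ : Ω → H}, MemLp β 2 P → MemLp Dβ 2 P →
      MemLp (fun ω => G.val ξ ω * β ω) 2 P ∧ MemLp (fun ω => G.val ξ ω • Dβ ω) 2 P ∧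
        MemLp (fun ω => β ω • G.grad ξ ω) 2 P := by
    intro β Dβ m1 m2
    refine ⟨memLp_bdd_smul m1 hGm (Eventually.of_forall hC),
      memLp_bdd_smul m2 hGm (Eventually.of_forall hC),
      m1.of_le_mul (c := C') (m1.1.smul (hξ.memLp_grad G).1) (Eventually.of_forall fun ω => ?_)⟩
    rw [norm_smul, mul_comm]
    gcongr
    exact hC' ω
  obtain ⟨m1, m2, F, t1, t2⟩ := hα
  obtain ⟨k1, k2, k3⟩ := key m1 m2
  refine ⟨k1, k2.add k3, fun n => G.mul (F n), ?_, ?_⟩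
  · simp only [Cylinder.val_mul]
    refine TendstoL2.of_norm_le t1 C fun n ω => ?_
    rw [← mul_sub, norm_mul]
    gcongr
    exact hC ω
  · simp only [Cylinder.grad_mul]
    have key' := fun n => key (hξ.memLp_val (F n)) (hξ.memLp_grad (F n))
    refine TendstoL2.add (fun n => (key' n).2.1.1) k2.1 (fun n => (key' n).2.2.1) k3.1 ?_ ?_
    · refine TendstoL2.of_norm_le t2 C fun n ω => ?_
      rw [← smul_sub, norm_smul]
      gcongr
      exact hC ω
    · refine TendstoL2.of_norm_le t1 C' fun n ω => ?_
      rw [← sub_smul, norm_smul, mul_comm]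
      gcongr
      exact hC' ω

theorem const_mul (hξ : IsIsonormal ξ P) (hα : HasStochDeriv ξ P α Dα) (c : ℝ) :
    HasStochDeriv ξ P (fun ω => c * α ω) (fun ω => c • Dα ω) := by
  simpa using hα.mul_cylinder hξ (Cylinder.const H c)

theorem sub (hξ : IsIsonormal ξ P) (hα : HasStochDeriv ξ P α Dα) (hβ : HasStochDeriv ξ P β Dβ) :
    HasStochDeriv ξ P (fun ω => α ω - β ω) (fun ω => Dα ω - Dβ ω) := by
  simpa [sub_eq_add_neg] using hα.add hξ (hβ.const_mul hξ (-1))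

theorem sum (hξ : IsIsonormal ξ P) {ι : Type*} (s : Finset ι) {a : ι → Ω → ℝ} {Da : ι → Ω → H}
    (h : ∀ i ∈ s, HasStochDeriv ξ P (a i) (Da i)) :
    HasStochDeriv ξ P (fun ω => ∑ i ∈ s, a i ω) (fun ω => ∑ i ∈ s, Da i ω) := by
  classical
  induction s using Finset.induction_on with
  | empty =>
    refine (hξ.hasStochDeriv_cylinder (Cylinder.const H 0)).congr ?_ ?_ <;>
      exact Eventually.of_forall fun ω => by simp
  | insert i s hi ih =>
    simp only [Finset.sum_insert hi]
    exact (h i (Finset.mem_insert_self i s)).add hξ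
      (ih fun j hj => h j (Finset.mem_insert_of_mem hj))

theorem aestronglyMeasurable [CompleteSpace H] (hξ : IsIsonormal ξ P)
    (h : HasStochDeriv ξ P α Dα) :
    AEStronglyMeasurable[sigmaAlgebra ξ] α P ∧ AEStronglyMeasurable[sigmaAlgebra ξ] Dα P := by
  obtain ⟨m1, m2, F, t1, t2⟩ := h
  exact ⟨TendstoL2.aestronglyMeasurable t1 (fun n => hξ.memLp_val _) m1 hξ.sigmaAlgebra_le
      fun n => ((F n).stronglyMeasurable_val ξ).aestronglyMeasurable,
    TendstoL2.aestronglyMeasurable t2 (fun n => hξ.memLp_grad _) m2 hξ.sigmaAlgebra_le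
      fun n => ((F n).stronglyMeasurable_grad ξ).aestronglyMeasurable⟩

end HasStochDeriv

/-! ### Stochastic differentiability of the Gaussian coordinates -/

/-- The bounded functions `m sin(t / m)` approximating the identity. -/
def trunc (m : ℝ) (t : ℝ) : ℝ := m * Real.sin (m⁻¹ * t)

theorem smoothBdd_trunc (m : ℝ) : SmoothBdd (trunc m) :=
  (SmoothBdd.const m).mul
    (SmoothBdd.sin.compCLM (m⁻¹ • ContinuousLinearMap.id ℝ ℝ : ℝ →L[ℝ] ℝ))

theorem hasDerivAt_trunc {m : ℝ} (hm : m ≠ 0) (t : ℝ) :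
    HasDerivAt (trunc m) (Real.cos (m⁻¹ * t)) t := by
  refine ((((hasDerivAt_id t).const_mul m⁻¹).sin).const_mul m).congr_deriv ?_
  simp only [id_eq]
  field_simp

theorem abs_trunc_le (m t : ℝ) : |trunc m t| ≤ |t| := by
  rcases eq_or_ne m 0 with rfl | hm
  · simp [trunc]
  rw [trunc, abs_mul]
  calc |m| * |Real.sin (m⁻¹ * t)| ≤ |m| * |m⁻¹ * t| := by
        exact mul_le_mul_of_nonneg_left Real.abs_sin_le_abs (abs_nonneg m)
    _ = |t| := by rw [← abs_mul, mul_inv_cancel_left₀ hm]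

/-- The values are difference quotients at 0, with step 1/(n + 1), of s ↦ sin(s t), whose derivative
there is t. -/
theorem tendsto_trunc (t : ℝ) : Tendsto (fun n : ℕ => trunc (n + 1 : ℝ) t) atTop (𝓝 t) := by
  have hd : HasDerivAt (fun s : ℝ => Real.sin (s * t)) t 0 := by
    simpa using ((hasDerivAt_id (0 : ℝ)).mul_const t).sin
  have h1 := hd.tendsto_slope_zero
  have h2 : Tendsto (fun n : ℕ => ((n : ℝ) + 1)⁻¹) atTop (𝓝[≠] 0) := by
    refine tendsto_nhdsWithin_iff.2 ⟨?_, Eventually.of_forall fun n => ?_⟩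
    · simpa using tendsto_one_div_add_atTop_nhds_zero_nat (𝕜 := ℝ)
    · simp only [Set.mem_compl_iff, Set.mem_singleton_iff]
      positivity
  refine (h1.comp h2).congr fun n => ?_
  simp [trunc]

theorem tendsto_cos_trunc (t : ℝ) :
    Tendsto (fun n : ℕ => Real.cos ((n + 1 : ℝ)⁻¹ * t)) atTop (𝓝 1) := by
  have h2 : Tendsto (fun n : ℕ => ((n : ℝ) + 1)⁻¹ * t) atTop (𝓝 0) := by
    simpa using (tendsto_one_div_add_atTop_nhds_zero_nat (𝕜 := ℝ)).mul_const t
  have := (Real.continuous_cos.tendsto 0).comp h2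
  rwa [Real.cos_zero] at this

/-- The identity is unbounded, so ξ k is reached by dominated convergence from m sin(ξ k / m), with
derivatives cos(ξ k / m) k. -/
theorem IsIsonormal.hasStochDeriv_eval (hξ : IsIsonormal ξ P) (k : H) :
    HasStochDeriv ξ P (ξ k) (fun _ => k) := by
  have := hξ.gaussian.isProbabilityMeasure
  refine ⟨hξ.memLp_two k, memLp_const k,
    fun n => Cylinder.ofFun (trunc (n + 1 : ℝ)) (smoothBdd_trunc _) k, ?_, ?_⟩
  · refine TendstoL2.of_dominated (g := fun ω => 2 * ‖ξ k ω‖) ((hξ.memLp_two k).norm.const_mul 2)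
      (fun n => (hξ.memLp_val _).1) (hξ.memLp_two k).1 (fun n ω => ?_) fun ω => ?_
    · refine (norm_sub_le _ _).trans ?_
      have := abs_trunc_le (n + 1 : ℝ) (ξ k ω)
      simp only [Cylinder.val_ofFun, Real.norm_eq_abs]
      linarith
    · simpa using tendsto_trunc (ξ k ω)
  · refine TendstoL2.of_dominated (g := fun _ => 2 * ‖k‖) (memLp_const _)
      (fun n => (hξ.memLp_grad _).1) aestronglyMeasurable_const (fun n ω => ?_) fun ω => ?_
    · refine (norm_sub_le _ _).trans ?_
      rw [Cylinder.grad_ofFun, (hasDerivAt_trunc (by positivity) _).deriv, norm_smul, two_mul]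
      gcongr
      exact mul_le_of_le_one_left (norm_nonneg k) (Real.abs_cos_le_one _)
    · have h : ∀ n : ℕ, (Cylinder.ofFun (trunc (n + 1 : ℝ)) (smoothBdd_trunc _) k).grad ξ ω =
          Real.cos ((n + 1 : ℝ)⁻¹ * ξ k ω) • k := fun n => by
        rw [Cylinder.grad_ofFun, (hasDerivAt_trunc (by positivity) _).deriv]
      simp_rw [h]
      simpa using (tendsto_cos_trunc (ξ k ω)).smul_const k

/-! ### The extended stochastic integral -/

/-- Square integrability of η makes both sides of the duality continuous in (α, Dα), which extends
it beyond cylindrical variables. -/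
theorem HasIntegral.integral_inner {y : Ω → H} {η α : Ω → ℝ} {Dα : Ω → H}
    (hξ : IsIsonormal ξ P) (h : HasIntegral ξ P y η) (hα : HasStochDeriv ξ P α Dα) :
    ∫ ω, ⟪y ω, Dα ω⟫ ∂P = ∫ ω, η ω * α ω ∂P := by
  obtain ⟨m1, m2, F, t1, t2⟩ := hα
  have h1 := TendstoL2.integral_inner (fun _ => h.1.1) h.1.1 (fun n => hξ.memLp_grad (F n)) m2
    (TendstoL2.const y) t2
  have h2 := TendstoL2.integral_mul (fun _ => h.2) h.2 (fun n => hξ.memLp_val (F n)) m1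
    (TendstoL2.const η) t1
  refine tendsto_nhds_unique h1 (h2.congr fun n => ?_)
  exact (h.1.2.2.2.2 (F n)).symm

theorem HasIntegralL1.ae_eq {y : Ω → H} {η η' : Ω → ℝ} (hξ : IsIsonormal ξ P)
    (h : HasIntegralL1 ξ P y η) (h' : HasIntegralL1 ξ P y η') : η =ᵐ[P] η' := by
  obtain ⟨-, -, i1, m1, e1⟩ := h
  obtain ⟨-, -, i2, m2, e2⟩ := h'
  have := ae_eq_zero_of_forall_integral_mul_val hξ (i1.sub i2) (m1.sub m2) fun F => by
    obtain ⟨C, hC⟩ := F.exists_abs_val_le ξ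
    have hF := (hξ.memLp_val F).1
    simp only [Pi.sub_apply, sub_mul]
    rw [integral_sub (i1.mul_bdd hF (Eventually.of_forall hC))
      (i2.mul_bdd hF (Eventually.of_forall hC)), ← e1, ← e2, sub_self]
  filter_upwards [this] with ω hω
  exact sub_eq_zero.1 hω

theorem HasIntegral.congr {y : Ω → H} {η η' : Ω → ℝ} (h : HasIntegral ξ P y η)
    (h1 : η =ᵐ[P] η') : HasIntegral ξ P y η' := by
  obtain ⟨⟨m1, s1, i1, s2, e⟩, m2⟩ := h
  refine ⟨⟨m1, s1, i1.congr h1, s2.congr h1, fun F => ?_⟩, m2.ae_eq h1⟩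
  rw [e]
  refine integral_congr_ae ?_
  filter_upwards [h1] with ω hω
  rw [hω]

theorem HasIntegral.of_tendsto [CompleteSpace H] (hξ : IsIsonormal ξ P) {y : ℕ → Ω → H}
    {η : ℕ → Ω → ℝ} {y' : Ω → H} {η' : Ω → ℝ} (h : ∀ n, HasIntegral ξ P (y n) (η n)) (hy : MemLp y' 2 P)
    (hη : MemLp η' 2 P) (t1 : TendstoL2 P y y') (t2 : TendstoL2 P η η') :
    HasIntegral ξ P y' η' := by
  have := hξ.gaussian.isProbabilityMeasure
  refine ⟨⟨hy, ?_, hη.integrable (by norm_num), ?_, fun F => ?_⟩, hη⟩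
  · exact t1.aestronglyMeasurable (fun n => (h n).1.1) hy hξ.sigmaAlgebra_le fun n => (h n).1.2.1
  · exact t2.aestronglyMeasurable (fun n => (h n).2) hη hξ.sigmaAlgebra_le
      fun n => (h n).1.2.2.2.1
  · have h1 := TendstoL2.integral_inner (fun n => (h n).1.1) hy (fun _ => hξ.memLp_grad F)
      (hξ.memLp_grad F) t1 (TendstoL2.const _)
    have h2 := TendstoL2.integral_mul (fun n => (h n).2) hη (fun _ => hξ.memLp_val F)
      (hξ.memLp_val F) t2 (TendstoL2.const _)
    refine tendsto_nhds_unique h1 (h2.congr fun n => ?_)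
    exact ((h n).1.2.2.2.2 F).symm

theorem HasIntegral.add {y y' : Ω → H} {η η' : Ω → ℝ} (hξ : IsIsonormal ξ P)
    (h : HasIntegral ξ P y η) (h' : HasIntegral ξ P y' η') :
    HasIntegral ξ P (fun ω => y ω + y' ω) (fun ω => η ω + η' ω) := by
  refine ⟨⟨h.1.1.add h'.1.1, h.1.2.1.add h'.1.2.1, h.1.2.2.1.add h'.1.2.2.1,
    h.1.2.2.2.1.add h'.1.2.2.2.1, fun F => ?_⟩, h.2.add h'.2⟩
  simp only [inner_add_left, add_mul]
  rw [integral_add (integrable_inner_of_memLp h.1.1 (hξ.memLp_grad F))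
      (integrable_inner_of_memLp h'.1.1 (hξ.memLp_grad F)),
    integral_add (f := fun ω => η ω * F.val ξ ω) (g := fun ω => η' ω * F.val ξ ω)
      (h.2.integrable_mul (hξ.memLp_val F))
      (h'.2.integrable_mul (hξ.memLp_val F)), h.1.2.2.2.2, h'.1.2.2.2.2]

theorem HasIntegral.zero (hξ : IsIsonormal ξ P) : HasIntegral ξ P (fun _ => 0) (fun _ => 0) := by
  have := hξ.gaussian.isProbabilityMeasure
  exact ⟨⟨memLp_const _, aestronglyMeasurable_const, integrable_const _,
    aestronglyMeasurable_const, fun F => by simp⟩, memLp_const _⟩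

theorem HasIntegral.sum (hξ : IsIsonormal ξ P) {ι : Type*} (s : Finset ι) {y : ι → Ω → H}
    {η : ι → Ω → ℝ} (h : ∀ i ∈ s, HasIntegral ξ P (y i) (η i)) :
    HasIntegral ξ P (fun ω => ∑ i ∈ s, y i ω) (fun ω => ∑ i ∈ s, η i ω) := by
  classical
  induction s using Finset.induction_on with
  | empty => simpa using HasIntegral.zero hξ
  | insert i s hi ih =>
    simp only [Finset.sum_insert hi]
    exact (h i (Finset.mem_insert_self i s)).add hξ
      (ih fun j hj => h j (Finset.mem_insert_of_mem hj))

/-- The stochastic integral of the random element `G k`. -/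
theorem IsIsonormal.hasIntegral_smul (hξ : IsIsonormal ξ P) (G : Cylinder H) (k : H) :
    HasIntegral ξ P (fun ω => G.val ξ ω • k)
      (fun ω => G.val ξ ω * ξ k ω - ⟪G.grad ξ ω, k⟫) := by
  have := hξ.gaussian.isProbabilityMeasure
  obtain ⟨C, hC⟩ := G.exists_abs_val_le ξ
  have hm1 : MemLp (fun ω => G.val ξ ω * ξ k ω) 2 P :=
    memLp_bdd_smul (hξ.memLp_two k) (hξ.memLp_val G).1 (Eventually.of_forall hC)
  have hm2 : MemLp (fun ω => ⟪G.grad ξ ω, k⟫) 2 P := by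
    simpa only [Cylinder.val_dirDeriv_eq] using hξ.memLp_val (G.dirDeriv k)
  have hm := hm1.sub hm2
  refine ⟨⟨memLp_bdd_smul (memLp_const k) (hξ.memLp_val G).1 (Eventually.of_forall hC),
    ((G.stronglyMeasurable_val ξ).smul_const k).aestronglyMeasurable,
    hm.integrable (by norm_num), ?_, fun F => ?_⟩, hm⟩
  · refine StronglyMeasurable.aestronglyMeasurable (StronglyMeasurable.sub
      ((G.stronglyMeasurable_val ξ).mul (measurable_sigmaAlgebra ξ k).stronglyMeasurable) ?_)
    have := (G.dirDeriv k).stronglyMeasurable_val ξ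
    simpa only [Cylinder.val_dirDeriv_eq] using this
  -- Integration by parts for GF; moving the term F (k, DG) to the left gives the duality for Gk.
  · have h := hξ.integral_val_mul (G.mul F) k
    simp only [Cylinder.val_mul, Cylinder.grad_mul, inner_add_right, real_inner_smul_right] at h
    have j1 : Integrable (fun ω => G.val ξ ω * ⟪k, F.grad ξ ω⟫) P := by
      have := (hξ.memLp_val G).integrable_mul (hξ.memLp_val (F.dirDeriv k))
      simpa [real_inner_comm, Pi.mul_def] using this
    have j2 : Integrable (fun ω => F.val ξ ω * ⟪k, G.grad ξ ω⟫) P := by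
      have := (hξ.memLp_val F).integrable_mul hm2
      simpa [real_inner_comm, Pi.mul_def] using this
    have j3 : Integrable (fun ω => G.val ξ ω * F.val ξ ω * ξ k ω) P := by
      have := hm1.integrable_mul (hξ.memLp_val F)
      refine this.congr (Eventually.of_forall fun ω => ?_)
      simp only [Pi.mul_apply]
      ring
    rw [integral_add j1 j2, ← sub_eq_iff_eq_add, ← integral_sub j3 j2] at h
    simp only [real_inner_smul_left]
    rw [← h]
    refine integral_congr_ae (Eventually.of_forall fun ω => ?_)
    simp only
    rw [real_inner_comm]
    ring

/-- The stochastic derivative is unique. -/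
theorem HasStochDeriv.inner_ae_eq [CompleteSpace H] (hξ : IsIsonormal ξ P) {α : Ω → ℝ}
    {D D' : Ω → H} (hD : HasStochDeriv ξ P α D) (hD' : HasStochDeriv ξ P α D') (h : H) :
    (fun ω => ⟪D ω, h⟫) =ᵐ[P] fun ω => ⟪D' ω, h⟫ := by
  have := hξ.gaussian.isProbabilityMeasure
  have mD : MemLp (fun ω => D ω - D' ω) 2 P := hD.2.1.sub hD'.2.1
  have hi : Integrable (fun ω => ⟪D ω - D' ω, h⟫) P :=
    integrable_inner_of_memLp mD (memLp_const h)
  have hs : AEStronglyMeasurable[sigmaAlgebra ξ] (fun ω => ⟪D ω - D' ω, h⟫) P :=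
    ((hD.aestronglyMeasurable hξ).2.sub (hD'.aestronglyMeasurable hξ).2).inner
      aestronglyMeasurable_const
  -- Duality with I(Fh) expresses E F (Dα, h) as E I(Fh) α, which does not involve the version of
  -- Dα.
  have := ae_eq_zero_of_forall_integral_mul_val hξ hi hs fun F => by
    have hF := hξ.hasIntegral_smul F h
    have e1 := hF.integral_inner hξ hD
    have e2 := hF.integral_inner hξ hD'
    rw [← sub_eq_zero, ← e2, ← integral_sub (integrable_inner_of_memLp hF.1.1 hD.2.1)
      (integrable_inner_of_memLp hF.1.1 hD'.2.1)] at e1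
    rw [← e1]
    refine integral_congr_ae (Eventually.of_forall fun ω => ?_)
    simp only
    rw [← inner_sub_right, real_inner_smul_left, real_inner_comm, mul_comm]
  filter_upwards [this] with ω hω
  rw [Pi.zero_apply, inner_sub_left, sub_eq_zero] at hω
  exact hω

/-! ### Elementary inequalities -/

theorem enorm_add_sq_le {E : Type*} [NormedAddCommGroup E] (a b : E) :
    ‖a + b‖ₑ ^ 2 ≤ 2 * ‖a‖ₑ ^ 2 + 2 * ‖b‖ₑ ^ 2 := by
  have h : ‖a + b‖₊ ^ 2 ≤ 2 * ‖a‖₊ ^ 2 + 2 * ‖b‖₊ ^ 2 := by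
    rw [← mul_add]
    exact (pow_le_pow_left' (nnnorm_add_le a b) 2).trans add_sq_le
  simp only [enorm_eq_nnnorm]
  exact_mod_cast h

theorem enorm_sub_sq_le {E : Type*} [NormedAddCommGroup E] (a b : E) :
    ‖a - b‖ₑ ^ 2 ≤ 2 * ‖a‖ₑ ^ 2 + 2 * ‖b‖ₑ ^ 2 := by
  simpa [sub_eq_add_neg] using enorm_add_sq_le a (-b)

theorem two_mul_enorm_inner_le (a b : H) : 2 * ‖⟪a, b⟫‖ₑ ≤ ‖a‖ₑ ^ 2 + ‖b‖ₑ ^ 2 := by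
  have h : 2 * ‖⟪a, b⟫‖₊ ≤ ‖a‖₊ ^ 2 + ‖b‖₊ ^ 2 := by
    refine le_trans ?_ (two_mul_le_add_sq ‖a‖₊ ‖b‖₊)
    rw [mul_assoc]
    gcongr
    exact nnnorm_inner_le_nnnorm (𝕜 := ℝ) a b
  simp only [enorm_eq_nnnorm]
  exact_mod_cast h

theorem enorm_le_tsum_of_hasSum {ι : Type*} {f : ι → ℝ} {a : ℝ} (h : HasSum f a) :
    ‖a‖ₑ ≤ ∑' i, ‖f i‖ₑ := by
  refine le_of_tendsto h.enorm (Eventually.of_forall fun s => ?_)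
  exact (enorm_sum_le s f).trans (ENNReal.sum_le_tsum s)

theorem lintegral_enorm_sq_eq {E : Type*} [NormedAddCommGroup E] {u : Ω → E} (hu : MemLp u 2 P) :
    ∫⁻ ω, ‖u ω‖ₑ ^ 2 ∂P = ENNReal.ofReal (∫ ω, ‖u ω‖ ^ 2 ∂P) := by
  rw [ofReal_integral_eq_lintegral_ofReal (hu.integrable_norm_pow (by norm_num))
    (Eventually.of_forall fun ω => sq_nonneg _)]
  refine lintegral_congr fun ω => ?_
  rw [ENNReal.ofReal_pow (norm_nonneg _), ofReal_norm]

/-! ### Hilbert-Schmidt estimates -/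

section HilbertSchmidt

variable [CompleteSpace H]

/-- Orthonormal vectors are √2 apart, so balls of radius 1/2 around them are disjoint. Countability
allows basis sums to be exchanged with expectations. -/
theorem countable_basisIndex (H : Type*) [NormedAddCommGroup H] [InnerProductSpace ℝ H]
    [CompleteSpace H] [TopologicalSpace.SeparableSpace H] : Countable (basisIndex H) := by
  have ho := (basis H).orthonormal
  have hd : (Set.univ : Set (basisIndex H)).PairwiseDisjoint
      fun i => Metric.ball (basis H i) (1 / 2) := by
    intro i _ j _ hij
    refine Metric.ball_disjoint_ball ?_
    have h2 : ‖basis H i - basis H j‖ ^ 2 = 2 := by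
      rw [norm_sub_sq_real, ho.1, ho.1, ho.2 hij]
      norm_num
    rw [dist_eq_norm]
    nlinarith [norm_nonneg (basis H i - basis H j)]
  have := hd.countable_of_isOpen (fun i _ => Metric.isOpen_ball)
    (fun i _ => ⟨basis H i, Metric.mem_ball_self (by norm_num)⟩)
  exact Set.countable_univ_iff.1 this

theorem hsSq_sub_le (A B : H →L[ℝ] H) : hsSq (A - B) ≤ 2 * hsSq A + 2 * hsSq B := by
  simp only [hsSq, ← ENNReal.tsum_mul_left]
  rw [← ENNReal.tsum_add]
  exact ENNReal.tsum_le_tsum fun i => enorm_sub_sq_le _ _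

theorem hsSq2_sub_le (A B : H →L[ℝ] H →L[ℝ] H) : hsSq2 (A - B) ≤ 2 * hsSq2 A + 2 * hsSq2 B := by
  simp only [hsSq2, ← ENNReal.tsum_mul_left]
  rw [← ENNReal.tsum_add]
  refine ENNReal.tsum_le_tsum fun i => ?_
  rw [← ENNReal.tsum_add]
  exact ENNReal.tsum_le_tsum fun j => enorm_sub_sq_le _ _

/-- Cauchy-Schwarz for (Th, e_i) = (h, T* e_i), together with equality of the Hilbert-Schmidt norms
of T and T*. -/
theorem enorm_apply_sq_le (T : H →L[ℝ] H) (h : H) : ‖T h‖ₑ ^ 2 ≤ ‖h‖ₑ ^ 2 * hsSq T := by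
  rw [enorm_sq_eq_tsum (basis H), hsSq, hsSq_aux (basis H) (basis H), ← ENNReal.tsum_mul_left]
  refine ENNReal.tsum_le_tsum fun i => ?_
  rw [← mul_pow, ← ContinuousLinearMap.adjoint_inner_right]
  refine pow_le_pow_left' ?_ 2
  simp only [enorm_eq_nnnorm]
  exact_mod_cast nnnorm_inner_le_nnnorm (𝕜 := ℝ) _ _

/-- The left-hand side is the absolute trace of T² for a finite-rank T. Written as ∑ (T e_i, T*
e_i), it is bounded through 2(a, b) ≤ ‖a‖² + ‖b‖². -/
theorem enorm_trace_sq_le {ι : Type*} [Fintype ι] (D k : ι → H) :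
    ‖∑ j, ⟪(∑ l, (innerSL ℝ (D l)).smulRight (k l) : H →L[ℝ] H) (k j), D j⟫‖ₑ ≤
      hsSq (∑ l, (innerSL ℝ (D l)).smulRight (k l) : H →L[ℝ] H) := by
  set T : H →L[ℝ] H := ∑ l, (innerSL ℝ (D l)).smulRight (k l) with hT
  have hTa : ∀ u, T u = ∑ l, ⟪D l, u⟫ • k l := fun u => by simp [hT]
  have h1 : HasSum (fun i => ⟪T (basis H i), ContinuousLinearMap.adjoint T (basis H i)⟫)
      (∑ j, ⟪T (k j), D j⟫) := by
    have h2 := hasSum_sum fun (j : ι) (_ : j ∈ Finset.univ) =>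
      (basis H).hasSum_inner_mul_inner (T (k j)) (D j)
    refine h2.congr_fun fun i => ?_
    rw [ContinuousLinearMap.adjoint_inner_right, hTa (basis H i), map_sum, sum_inner]
    refine Finset.sum_congr rfl fun j _ => ?_
    rw [map_smul, real_inner_smul_left, real_inner_comm (D j), mul_comm]
  have h3 : 2 * ‖∑ j, ⟪T (k j), D j⟫‖ₑ ≤ 2 * hsSq T := by
    calc 2 * ‖∑ j, ⟪T (k j), D j⟫‖ₑ
        ≤ 2 * ∑' i, ‖⟪T (basis H i), ContinuousLinearMap.adjoint T (basis H i)⟫‖ₑ := by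
          gcongr
          exact enorm_le_tsum_of_hasSum h1
      _ = ∑' i, 2 * ‖⟪T (basis H i), ContinuousLinearMap.adjoint T (basis H i)⟫‖ₑ :=
          ENNReal.tsum_mul_left.symm
      _ ≤ ∑' i, (‖T (basis H i)‖ₑ ^ 2 + ‖ContinuousLinearMap.adjoint T (basis H i)‖ₑ ^ 2) :=
          ENNReal.tsum_le_tsum fun i => two_mul_enorm_inner_le _ _
      _ = 2 * hsSq T := by
          rw [ENNReal.tsum_add, ← hsSq_aux (basis H) (basis H), two_mul, hsSq]
  exact (ENNReal.mul_le_mul_iff_right (by norm_num) (by norm_num)).1 h3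

end HilbertSchmidt

/-! ### The stochastic integral of smooth cylindrical random elements -/

namespace VecCylinder

/-- The stochastic integral `∑ⱼ Fⱼ (kⱼ, ξ) - (DFⱼ, kⱼ)`. -/
def skorohod (F : VecCylinder H) (ξ : H → Ω → ℝ) (ω : Ω) : ℝ :=
  ∑ j, ((F.coeff j).val ξ ω * ξ (F.vec j) ω - ⟪(F.coeff j).grad ξ ω, F.vec j⟫)

/-- The stochastic derivative of the stochastic integral. -/
def skorohodGrad (F : VecCylinder H) (ξ : H → Ω → ℝ) (ω : Ω) : H :=
  ∑ j, ((F.coeff j).val ξ ω • F.vec j + ξ (F.vec j) ω • (F.coeff j).grad ξ ω -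
    ((F.coeff j).dirDeriv (F.vec j)).grad ξ ω)

/-- The random element `(DF, h)`. -/
def dirDeriv (F : VecCylinder H) (h : H) : VecCylinder H where
  m := F.m
  coeff j := (F.coeff j).dirDeriv h
  vec := F.vec

/-- The difference of two smooth cylindrical random elements. -/
def sub (F G : VecCylinder H) : VecCylinder H where
  m := F.m + G.m
  coeff := Fin.append F.coeff G.coeff
  vec := Fin.append F.vec fun j => -G.vec j

variable (F G : VecCylinder H) (ω : Ω)

theorem val_dirDeriv (h : H) : (F.dirDeriv h).val ξ ω = F.deriv ξ ω h := by
  simp [val, dirDeriv, deriv]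
  rfl

theorem deriv_dirDeriv (h u : H) : (F.dirDeriv h).deriv ξ ω u = F.deriv2 ξ ω u h := by
  simp [deriv, dirDeriv, deriv2, Cylinder.inner_grad_dirDeriv]
  rfl

/-- The commutation relation for cylindrical elements. D²F_j is evaluated at (h, k_j) on one side
and at (k_j, h) on the other, so symmetry of second derivatives is the point. -/
theorem inner_skorohodGrad (h : H) :
    ⟪F.skorohodGrad ξ ω, h⟫ = ⟪F.val ξ ω, h⟫ + (F.dirDeriv h).skorohod ξ ω := by
  have h1 : (F.dirDeriv h).skorohod ξ ω = ∑ j : Fin F.m,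
    (((F.coeff j).dirDeriv h).val ξ ω * ξ (F.vec j) ω -
      ⟪((F.coeff j).dirDeriv h).grad ξ ω, F.vec j⟫) := rfl
  rw [h1]
  simp only [skorohodGrad, val, sum_inner, ← Finset.sum_add_distrib]
  refine Finset.sum_congr rfl fun j _ => ?_
  simp only [inner_sub_left, inner_add_left, real_inner_smul_left, Cylinder.val_dirDeriv,
    Cylinder.inner_grad_dirDeriv]
  rw [Cylinder.hess_symm]
  ring

theorem val_sub : (F.sub G).val ξ ω = F.val ξ ω - G.val ξ ω := by
  have h : (F.sub G).val ξ ω = ∑ j : Fin (F.m + G.m), (Fin.append F.coeff G.coeff j).val ξ ω •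
    Fin.append F.vec (fun j => -G.vec j) j := rfl
  rw [h, Fin.sum_univ_add]
  simp [val, sub_eq_add_neg]

theorem deriv_sub : (F.sub G).deriv ξ ω = F.deriv ξ ω - G.deriv ξ ω := by
  have h : (F.sub G).deriv ξ ω = ∑ j : Fin (F.m + G.m),
    (innerSL ℝ ((Fin.append F.coeff G.coeff j).grad ξ ω)).smulRight
      (Fin.append F.vec (fun j => -G.vec j) j) := rfl
  rw [h, Fin.sum_univ_add]
  ext u
  simp [deriv, sub_eq_add_neg]

theorem deriv2_sub : (F.sub G).deriv2 ξ ω = F.deriv2 ξ ω - G.deriv2 ξ ω := by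
  have h : (F.sub G).deriv2 ξ ω = ∑ j : Fin (F.m + G.m),
    (ContinuousLinearMap.smulRightL ℝ H H).flip (Fin.append F.vec (fun j => -G.vec j) j) ∘L
      (Fin.append F.coeff G.coeff j).hess ξ ω := rfl
  rw [h, Fin.sum_univ_add]
  ext u v
  simp [deriv2, sub_eq_add_neg]

/-- Only almost sure, because ξ(-k) = -ξ(k) is. -/
theorem skorohod_sub (hξ : IsIsonormal ξ P) :
    ∀ᵐ ω ∂P, (F.sub G).skorohod ξ ω = F.skorohod ξ ω - G.skorohod ξ ω ∧
      (F.sub G).skorohodGrad ξ ω = F.skorohodGrad ξ ω - G.skorohodGrad ξ ω := by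
  have hneg : ∀ᵐ ω ∂P, ∀ j, ξ (-G.vec j) ω = -ξ (G.vec j) ω := ae_all_iff.2 fun j => by
    filter_upwards [hξ.linear (-1) 0 (G.vec j) 0] with ω hω
    simpa using hω
  filter_upwards [hneg] with ω hω
  constructor
  · have h : (F.sub G).skorohod ξ ω = ∑ j : Fin (F.m + G.m),
      ((Fin.append F.coeff G.coeff j).val ξ ω * ξ (Fin.append F.vec (fun j => -G.vec j) j) ω -
        ⟪(Fin.append F.coeff G.coeff j).grad ξ ω, Fin.append F.vec (fun j => -G.vec j) j⟫) := rfl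
    rw [h, Fin.sum_univ_add]
    simp only [Fin.append_left, Fin.append_right, skorohod, sub_eq_add_neg, ← Finset.sum_neg_distrib,
      hω, inner_neg_right]
    congr 1
    refine Finset.sum_congr rfl fun j _ => ?_
    ring
  · refine ext_inner_right ℝ fun u => ?_
    have h : (F.sub G).skorohodGrad ξ ω = ∑ j : Fin (F.m + G.m),
      ((Fin.append F.coeff G.coeff j).val ξ ω • Fin.append F.vec (fun j => -G.vec j) j +
        ξ (Fin.append F.vec (fun j => -G.vec j) j) ω • (Fin.append F.coeff G.coeff j).grad ξ ω -
        ((Fin.append F.coeff G.coeff j).dirDeriv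
          (Fin.append F.vec (fun j => -G.vec j) j)).grad ξ ω) := rfl
    rw [h, Fin.sum_univ_add]
    simp only [Fin.append_left, Fin.append_right, skorohodGrad, inner_add_left, inner_sub_left,
      sum_inner, hω, real_inner_smul_left, inner_neg_left, Cylinder.inner_grad_dirDeriv, map_neg]
    rw [sub_eq_add_neg, ← Finset.sum_neg_distrib]
    congr 1
    refine Finset.sum_congr rfl fun j _ => ?_
    ring

theorem hasIntegral (hξ : IsIsonormal ξ P) : HasIntegral ξ P (F.val ξ) (F.skorohod ξ) :=
  HasIntegral.sum hξ Finset.univ fun j _ => hξ.hasIntegral_smul (F.coeff j) (F.vec j)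

theorem hasStochDeriv (hξ : IsIsonormal ξ P) :
    HasStochDeriv ξ P (F.skorohod ξ) (F.skorohodGrad ξ) := by
  refine HasStochDeriv.sum hξ Finset.univ fun j _ => ?_
  refine HasStochDeriv.sub hξ ((hξ.hasStochDeriv_eval (F.vec j)).mul_cylinder hξ (F.coeff j)) ?_
  rw [← Cylinder.val_dirDeriv_eq]
  exact hξ.hasStochDeriv_cylinder _

/-- Duality with the variable I(F) gives E I(F)² = E (F, DI(F)). Commutation splits off ‖F‖² and
leaves the terms I((DF, k_j)) F_j, to which duality applies once more. -/
theorem integral_skorohod_sq (hξ : IsIsonormal ξ P) :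
    ∫ ω, F.skorohod ξ ω ^ 2 ∂P =
      ∫ ω, ‖F.val ξ ω‖ ^ 2 ∂P +
        ∫ ω, ∑ j, ⟪F.deriv ξ ω (F.vec j), (F.coeff j).grad ξ ω⟫ ∂P := by
  have h1 := (F.hasIntegral hξ).integral_inner hξ (F.hasStochDeriv hξ)
  have hI : ∀ j, HasIntegral ξ P (fun ω => F.deriv ξ ω (F.vec j))
      ((F.dirDeriv (F.vec j)).skorohod ξ) := fun j => by
    have := (F.dirDeriv (F.vec j)).hasIntegral hξ
    rwa [show (F.dirDeriv (F.vec j)).val ξ = fun ω => F.deriv ξ ω (F.vec j) from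
      funext fun ω => F.val_dirDeriv ω (F.vec j)] at this
  have e1 : ∀ ω, ⟪F.val ξ ω, F.skorohodGrad ξ ω⟫ = ‖F.val ξ ω‖ ^ 2 +
      ∑ j, (F.dirDeriv (F.vec j)).skorohod ξ ω * (F.coeff j).val ξ ω := fun ω => by
    conv_lhs => rw [val]
    rw [sum_inner]
    simp only [real_inner_smul_left]
    have : ∀ j, ⟪F.vec j, F.skorohodGrad ξ ω⟫ =
        ⟪F.vec j, F.val ξ ω⟫ + (F.dirDeriv (F.vec j)).skorohod ξ ω := fun j => by
      rw [real_inner_comm, inner_skorohodGrad, real_inner_comm]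
    simp only [this, mul_add, Finset.sum_add_distrib]
    congr 1
    · rw [← real_inner_self_eq_norm_sq]
      conv_rhs => rw [val, sum_inner]
      simp only [real_inner_smul_left]
      rfl
    · exact Finset.sum_congr rfl fun j _ => mul_comm _ _
  have i1 : Integrable (fun ω => ‖F.val ξ ω‖ ^ 2) P :=
    (F.hasIntegral hξ).1.1.integrable_norm_pow (by norm_num)
  have i2 : ∀ j, Integrable (fun ω => (F.dirDeriv (F.vec j)).skorohod ξ ω *
      (F.coeff j).val ξ ω) P := fun j => (hI j).2.integrable_mul (hξ.memLp_val _)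
  simp_rw [e1] at h1
  rw [integral_add i1 (integrable_finsetSum _ fun j _ => i2 j),
    integral_finsetSum _ fun j _ => i2 j] at h1
  simp_rw [← (hI _).1.2.2.2.2] at h1
  rw [integral_finsetSum _ fun j _ => integrable_inner_of_memLp (hI j).1.1 (hξ.memLp_grad _), h1]
  exact integral_congr_ae (Eventually.of_forall fun ω => sq _)

variable [CompleteSpace H]

theorem lintegral_skorohod_sq_le (hξ : IsIsonormal ξ P) :
    ∫⁻ ω, ‖F.skorohod ξ ω‖ₑ ^ 2 ∂P ≤
      ∫⁻ ω, ‖F.val ξ ω‖ₑ ^ 2 ∂P + ∫⁻ ω, hsSq (F.deriv ξ ω) ∂P := by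
  rw [lintegral_enorm_sq_eq (F.hasIntegral hξ).2, lintegral_enorm_sq_eq (F.hasIntegral hξ).1.1]
  simp only [Real.norm_eq_abs, sq_abs]
  rw [F.integral_skorohod_sq hξ]
  refine ENNReal.ofReal_add_le.trans (add_le_add le_rfl ?_)
  refine (Real.ofReal_le_enorm _).trans ((enorm_integral_le_lintegral_enorm _).trans ?_)
  exact lintegral_mono fun ω => enorm_trace_sq_le _ _

/-- By Parseval and commutation the norm is a sum over i of ((F, e_i) + I((DF, e_i)))². The previous
bound for each (DF, e_i) then brings in D²F. -/
theorem lintegral_skorohodGrad_sq_le [TopologicalSpace.SeparableSpace H]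
    (hξ : IsIsonormal ξ P) :
    ∫⁻ ω, ‖F.skorohodGrad ξ ω‖ₑ ^ 2 ∂P ≤
      2 * ∫⁻ ω, ‖F.val ξ ω‖ₑ ^ 2 ∂P + 2 * (∫⁻ ω, hsSq (F.deriv ξ ω) ∂P +
        ∫⁻ ω, hsSq2 (F.deriv2 ξ ω) ∂P) := by
  have := countable_basisIndex H
  have hv : AEStronglyMeasurable (F.val ξ) P := (F.hasIntegral hξ).1.1.1
  have m1 : ∀ i, AEMeasurable (fun ω => ‖⟪F.val ξ ω, basis H i⟫‖ₑ ^ 2) P := fun i =>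
    (hv.inner aestronglyMeasurable_const).enorm.pow_const 2
  have m2 : ∀ h, AEMeasurable (fun ω => ‖(F.dirDeriv h).skorohod ξ ω‖ₑ ^ 2) P := fun h =>
    ((F.dirDeriv h).hasIntegral hξ).2.1.enorm.pow_const 2
  have m3 : ∀ h, AEStronglyMeasurable (fun ω => F.deriv ξ ω h) P := fun h => by
    simp only [← val_dirDeriv]
    exact ((F.dirDeriv h).hasIntegral hξ).1.1.1
  have m4 : ∀ h u, AEStronglyMeasurable (fun ω => F.deriv2 ξ ω u h) P := fun h u => by
    simp only [← deriv_dirDeriv, ← val_dirDeriv]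
    exact (((F.dirDeriv h).dirDeriv u).hasIntegral hξ).1.1.1
  calc ∫⁻ ω, ‖F.skorohodGrad ξ ω‖ₑ ^ 2 ∂P
      = ∫⁻ ω, ∑' i, ‖⟪F.val ξ ω, basis H i⟫ + (F.dirDeriv (basis H i)).skorohod ξ ω‖ₑ ^ 2 ∂P := by
        simp_rw [← inner_skorohodGrad, ← enorm_sq_eq_tsum]
    _ ≤ ∫⁻ ω, ∑' i, (2 * ‖⟪F.val ξ ω, basis H i⟫‖ₑ ^ 2 +
          2 * ‖(F.dirDeriv (basis H i)).skorohod ξ ω‖ₑ ^ 2) ∂P :=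
        lintegral_mono fun ω => ENNReal.tsum_le_tsum fun i => enorm_add_sq_le _ _
    _ = 2 * ∫⁻ ω, ∑' i, ‖⟪F.val ξ ω, basis H i⟫‖ₑ ^ 2 ∂P +
          2 * ∑' i, ∫⁻ ω, ‖(F.dirDeriv (basis H i)).skorohod ξ ω‖ₑ ^ 2 ∂P := by
        rw [← lintegral_tsum fun i => m2 _, ← lintegral_const_mul'' _ (AEMeasurable.tsum m1),
          ← lintegral_const_mul'' _ (AEMeasurable.tsum fun i => m2 _),
          ← lintegral_add_left' ((AEMeasurable.tsum m1).const_mul 2)]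
        simp_rw [ENNReal.tsum_add, ENNReal.tsum_mul_left]
    _ ≤ 2 * ∫⁻ ω, ‖F.val ξ ω‖ₑ ^ 2 ∂P +
          2 * ∑' i, (∫⁻ ω, ‖F.deriv ξ ω (basis H i)‖ₑ ^ 2 ∂P +
            ∫⁻ ω, ∑' k, ‖F.deriv2 ξ ω (basis H k) (basis H i)‖ₑ ^ 2 ∂P) := by
        simp_rw [← enorm_sq_eq_tsum]
        gcongr with i
        refine ((F.dirDeriv (basis H i)).lintegral_skorohod_sq_le hξ).trans (le_of_eq ?_)
        simp_rw [val_dirDeriv, hsSq, deriv_dirDeriv]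
    _ = _ := by
        rw [ENNReal.tsum_add, ← lintegral_tsum fun i => (m3 _).enorm.pow_const 2,
          ← lintegral_tsum fun i => AEMeasurable.tsum fun k => (m4 _ _).enorm.pow_const 2]
        simp_rw [hsSq, hsSq2]
        congr 4
        ext ω
        exact ENNReal.tsum_comm

end VecCylinder

variable [CompleteSpace H]

/-! ### The stochastic integral of a twice stochastically differentiable random element -/

theorem tendsto_add_prod {d : ℕ → ℝ≥0∞} (hd : Tendsto d atTop (𝓝 0)) :
    Tendsto (fun p : ℕ × ℕ => 2 * d p.1 + 2 * d p.2) atTop (𝓝 0) := by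
  have h2 : Tendsto (fun n => 2 * d n) atTop (𝓝 0) := by
    simpa using ENNReal.Tendsto.const_mul hd (Or.inr ENNReal.ofNat_ne_top)
  rw [← prod_atTop_atTop_eq]
  simpa using (h2.comp tendsto_fst).add (h2.comp tendsto_snd)

/-- The two mean square bounds, applied to differences of approximants, make the integrals and their
derivatives Cauchy. The second derivative of x enters only for the latter. -/
theorem HasTwoStochDerivs.exists_approx [TopologicalSpace.SeparableSpace H]
    (hξ : IsIsonormal ξ P) {x : Ω → H} {Dx : Ω → H →L[ℝ] H} {D2x : Ω → H →L[ℝ] H →L[ℝ] H}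
    (hx : HasTwoStochDerivs ξ P x Dx D2x) :
    ∃ (F : ℕ → VecCylinder H) (Ix : Ω → ℝ) (DIx : Ω → H), MemLp Ix 2 P ∧ MemLp DIx 2 P ∧
      TendstoL2 P (fun n => (F n).val ξ) x ∧
      (∀ h, TendstoL2 P (fun n ω => (F n).deriv ξ ω h) fun ω => Dx ω h) ∧
      TendstoL2 P (fun n => (F n).skorohod ξ) Ix ∧
      TendstoL2 P (fun n => (F n).skorohodGrad ξ) DIx := by
  have := countable_basisIndex H
  obtain ⟨mx, mDx, mD2x, F, t0, t1, t2⟩ := hx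
  have t0' := tendstoL2_iff.1 t0
  have mF : ∀ n, AEStronglyMeasurable ((F n).val ξ) P := fun n => ((F n).hasIntegral hξ).1.1.1
  have mF1 : ∀ n h, AEStronglyMeasurable (fun ω => (F n).deriv ξ ω h) P := fun n h => by
    simp only [← VecCylinder.val_dirDeriv]
    exact (((F n).dirDeriv h).hasIntegral hξ).1.1.1
  have mF2 : ∀ n u h, AEStronglyMeasurable (fun ω => (F n).deriv2 ξ ω u h) P := fun n u h => by
    simp only [← VecCylinder.deriv_dirDeriv, ← VecCylinder.val_dirDeriv]
    exact ((((F n).dirDeriv h).dirDeriv u).hasIntegral hξ).1.1.1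
  have m0 : ∀ n, AEMeasurable (fun ω => ‖(F n).val ξ ω - x ω‖ₑ ^ 2) P := fun n =>
    ((mF n).sub mx.1).enorm.pow_const 2
  have m1 : ∀ n, AEMeasurable (fun ω => hsSq ((F n).deriv ξ ω - Dx ω)) P := fun n =>
    AEMeasurable.tsum fun i => ((mF1 n _).sub (mDx _)).enorm.pow_const 2
  have m2 : ∀ n, AEMeasurable (fun ω => hsSq2 ((F n).deriv2 ξ ω - D2x ω)) P := fun n =>
    AEMeasurable.tsum fun i => AEMeasurable.tsum fun j =>
      ((mF2 n _ _).sub (mD2x _ _)).enorm.pow_const 2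
  have b0 : ∀ p : ℕ × ℕ, ∫⁻ ω, ‖((F p.1).sub (F p.2)).val ξ ω‖ₑ ^ 2 ∂P ≤
      2 * ∫⁻ ω, ‖(F p.1).val ξ ω - x ω‖ₑ ^ 2 ∂P + 2 * ∫⁻ ω, ‖(F p.2).val ξ ω - x ω‖ₑ ^ 2 ∂P := by
    intro p
    rw [← lintegral_const_mul'' _ (m0 _), ← lintegral_const_mul'' _ (m0 _),
      ← lintegral_add_left' ((m0 _).const_mul 2)]
    refine lintegral_mono fun ω => ?_
    rw [VecCylinder.val_sub, ← sub_sub_sub_cancel_right _ _ (x ω)]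
    exact enorm_sub_sq_le _ _
  have b1 : ∀ p : ℕ × ℕ, ∫⁻ ω, hsSq (((F p.1).sub (F p.2)).deriv ξ ω) ∂P ≤
      2 * ∫⁻ ω, hsSq ((F p.1).deriv ξ ω - Dx ω) ∂P +
        2 * ∫⁻ ω, hsSq ((F p.2).deriv ξ ω - Dx ω) ∂P := by
    intro p
    rw [← lintegral_const_mul'' _ (m1 _), ← lintegral_const_mul'' _ (m1 _),
      ← lintegral_add_left' ((m1 _).const_mul 2)]
    refine lintegral_mono fun ω => ?_
    rw [VecCylinder.deriv_sub, ← sub_sub_sub_cancel_right _ _ (Dx ω)]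
    exact hsSq_sub_le _ _
  have b2 : ∀ p : ℕ × ℕ, ∫⁻ ω, hsSq2 (((F p.1).sub (F p.2)).deriv2 ξ ω) ∂P ≤
      2 * ∫⁻ ω, hsSq2 ((F p.1).deriv2 ξ ω - D2x ω) ∂P +
        2 * ∫⁻ ω, hsSq2 ((F p.2).deriv2 ξ ω - D2x ω) ∂P := by
    intro p
    rw [← lintegral_const_mul'' _ (m2 _), ← lintegral_const_mul'' _ (m2 _),
      ← lintegral_add_left' ((m2 _).const_mul 2)]
    refine lintegral_mono fun ω => ?_
    rw [VecCylinder.deriv2_sub, ← sub_sub_sub_cancel_right _ _ (D2x ω)]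
    exact hsSq2_sub_le _ _
  have z0 := tendsto_of_tendsto_of_tendsto_of_le_of_le tendsto_const_nhds (tendsto_add_prod t0')
    (fun _ => zero_le) b0
  have z1 := tendsto_of_tendsto_of_tendsto_of_le_of_le tendsto_const_nhds (tendsto_add_prod t1)
    (fun _ => zero_le) b1
  have z2 := tendsto_of_tendsto_of_tendsto_of_le_of_le tendsto_const_nhds (tendsto_add_prod t2)
    (fun _ => zero_le) b2
  obtain ⟨Ix, mIx, hIx⟩ := exists_tendstoL2 (fun n => ((F n).hasIntegral hξ).2) (by
    refine tendsto_of_tendsto_of_tendsto_of_le_of_le tendsto_const_nhds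
      (by simpa using z0.add z1) (fun _ => zero_le) fun p => ?_
    refine le_trans (le_of_eq ?_) (((F p.1).sub (F p.2)).lintegral_skorohod_sq_le hξ)
    refine lintegral_congr_ae ?_
    filter_upwards [(F p.1).skorohod_sub (F p.2) hξ] with ω hω
    rw [hω.1])
  obtain ⟨DIx, mDIx, hDIx⟩ := exists_tendstoL2 (fun n => ((F n).hasStochDeriv hξ).2.1) (by
    have hz : Tendsto (fun p : ℕ × ℕ =>
        2 * ∫⁻ ω, ‖((F p.1).sub (F p.2)).val ξ ω‖ₑ ^ 2 ∂P +
          2 * (∫⁻ ω, hsSq (((F p.1).sub (F p.2)).deriv ξ ω) ∂P +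
            ∫⁻ ω, hsSq2 (((F p.1).sub (F p.2)).deriv2 ξ ω) ∂P)) atTop (𝓝 0) := by
      have := (ENNReal.Tendsto.const_mul z0 (Or.inr (ENNReal.ofNat_ne_top (n := 2)))).add
        (ENNReal.Tendsto.const_mul (z1.add z2) (Or.inr (ENNReal.ofNat_ne_top (n := 2))))
      simpa using this
    refine tendsto_of_tendsto_of_tendsto_of_le_of_le tendsto_const_nhds hz
      (fun _ => zero_le) fun p => ?_
    refine le_trans (le_of_eq ?_) (((F p.1).sub (F p.2)).lintegral_skorohodGrad_sq_le hξ)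
    refine lintegral_congr_ae ?_
    filter_upwards [(F p.1).skorohod_sub (F p.2) hξ] with ω hω
    rw [hω.2])
  refine ⟨F, Ix, DIx, mIx, mDIx, t0, fun h => tendstoL2_iff.2 ?_, hIx, hDIx⟩
  have hz : Tendsto (fun n => ‖h‖ₑ ^ 2 * ∫⁻ ω, hsSq ((F n).deriv ξ ω - Dx ω) ∂P) atTop (𝓝 0) := by
    simpa using ENNReal.Tendsto.const_mul t1 (Or.inr (by finiteness : ‖h‖ₑ ^ 2 ≠ ⊤))
  refine tendsto_of_tendsto_of_tendsto_of_le_of_le tendsto_const_nhds hz (fun _ => zero_le)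
    fun n => ?_
  rw [← lintegral_const_mul' _ _ (by finiteness)]
  exact lintegral_mono fun ω => enorm_apply_sq_le ((F n).deriv ξ ω - Dx ω) h

/-- Existence of I((Dx, h)) cannot be read off from existence of I(x), since no second derivative of
(Dx, h) is given. It comes with its value, as the limit of the cylindrical commutation relation. -/
theorem HasTwoStochDerivs.exists_integral [TopologicalSpace.SeparableSpace H]
    (hξ : IsIsonormal ξ P) {x : Ω → H} {Dx : Ω → H →L[ℝ] H} {D2x : Ω → H →L[ℝ] H →L[ℝ] H}
    (hx : HasTwoStochDerivs ξ P x Dx D2x) :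
    ∃ (Ix : Ω → ℝ) (DIx : Ω → H), HasIntegral ξ P x Ix ∧ HasStochDeriv ξ P Ix DIx ∧
      ∀ h, HasIntegral ξ P (fun ω => Dx ω h) fun ω => ⟪DIx ω, h⟫ - ⟪x ω, h⟫ := by
  have := hξ.gaussian.isProbabilityMeasure
  obtain ⟨F, Ix, DIx, mIx, mDIx, t0, t1, tI, tD⟩ := hx.exists_approx hξ
  have inner_bound : ∀ (h : H) {u : ℕ → Ω → H} {v : Ω → H}, TendstoL2 P u v →
      TendstoL2 P (fun n ω => ⟪u n ω, h⟫) fun ω => ⟪v ω, h⟫ := fun h u v huv =>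
    huv.of_norm_le ‖h‖ fun n ω => by
      rw [← inner_sub_left, mul_comm]
      exact norm_inner_le_norm _ _
  have inner_memLp : ∀ (h : H) {u : Ω → H}, MemLp u 2 P → MemLp (fun ω => ⟪u ω, h⟫) 2 P :=
    fun h u hu => hu.of_le_mul (c := ‖h‖) (hu.1.inner aestronglyMeasurable_const)
      (Eventually.of_forall fun ω => by
        rw [mul_comm]
        exact norm_inner_le_norm _ _)
  refine ⟨Ix, DIx, HasIntegral.of_tendsto hξ (fun n => (F n).hasIntegral hξ) hx.1 mIx t0 tI,
    HasStochDeriv.of_tendsto hξ (fun n => (F n).hasStochDeriv hξ) mIx mDIx tI tD, fun h => ?_⟩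
  have hI : ∀ n, HasIntegral ξ P (fun ω => (F n).deriv ξ ω h)
      fun ω => ⟪(F n).skorohodGrad ξ ω, h⟫ - ⟪(F n).val ξ ω, h⟫ := fun n => by
    have := ((F n).dirDeriv h).hasIntegral hξ
    rw [show ((F n).dirDeriv h).val ξ = fun ω => (F n).deriv ξ ω h from
      funext fun ω => (F n).val_dirDeriv ω h] at this
    refine this.congr (Eventually.of_forall fun ω => ?_)
    simp only [VecCylinder.inner_skorohodGrad, add_sub_cancel_left]
  refine HasIntegral.of_tendsto hξ hI
    ((t1 h).memLp (fun n => (hI n).1.1) (hx.2.1 h))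
    ((inner_memLp h mDIx).sub (inner_memLp h hx.1)) (t1 h) ?_
  have mv := fun n => ((F n).hasIntegral hξ).1.1
  have ms := fun n => ((F n).hasStochDeriv hξ).2.1
  simp only [sub_eq_add_neg]
  exact TendstoL2.add (fun n => (inner_memLp h (ms n)).1) (inner_memLp h mDIx).1
    (fun n => (inner_memLp h (mv n)).1.neg) (inner_memLp h hx.1).1.neg
    (inner_bound h tD) (inner_bound h t0).neg

/-- Duality of x with Gα and the Leibniz rule. Boundedness of α only keeps αx square integrable; (x,
Dα), a product of two L² elements, is merely integrable, whence the L¹ sense. -/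
theorem HasIntegral.smul (hξ : IsIsonormal ξ P) {x : Ω → H} {Ix α : Ω → ℝ} {Dα : Ω → H}
    (hI : HasIntegral ξ P x Ix) (hα : HasStochDeriv ξ P α Dα)
    (hb : ∃ C : ℝ, ∀ᵐ ω ∂P, |α ω| ≤ C) :
    HasIntegralL1 ξ P (fun ω => α ω • x ω) fun ω => α ω * Ix ω - ⟪x ω, Dα ω⟫ := by
  obtain ⟨C, hC⟩ := hb
  have hm : MemLp (fun ω => α ω • x ω) 2 P := memLp_bdd_smul hI.1.1 hα.1.1 hC
  have hs := hα.aestronglyMeasurable hξ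
  have i1 : Integrable (fun ω => α ω * Ix ω) P := hα.1.integrable_mul hI.2
  have i2 : Integrable (fun ω => ⟪x ω, Dα ω⟫) P := integrable_inner_of_memLp hI.1.1 hα.2.1
  refine ⟨hm, hs.1.smul hI.1.2.1, i1.sub i2,
    (hs.1.mul hI.1.2.2.2.1).sub (hI.1.2.1.inner hs.2), fun G => ?_⟩
  obtain ⟨C', hC'⟩ := G.exists_abs_val_le ξ
  have hG := (hξ.memLp_val G).1
  have h := hI.integral_inner hξ (hα.mul_cylinder hξ G)
  have j1 : Integrable (fun ω => G.val ξ ω * ⟪x ω, Dα ω⟫) P :=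
    i2.bdd_mul hG (Eventually.of_forall hC')
  have j2 : Integrable (fun ω => α ω * ⟪x ω, G.grad ξ ω⟫) P := by
    simpa only [real_inner_smul_left] using integrable_inner_of_memLp hm (hξ.memLp_grad G)
  have j3 : Integrable (fun ω => Ix ω * (G.val ξ ω * α ω)) P :=
    (i1.bdd_mul hG (Eventually.of_forall hC')).congr (Eventually.of_forall fun ω => by
      simp only
      ring)
  simp only [inner_add_right, real_inner_smul_right] at h
  rw [integral_add j1 j2, ← eq_sub_iff_add_eq', ← integral_sub j3 j1] at h
  simp only [real_inner_smul_left]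
  rw [h]
  refine integral_congr_ae (Eventually.of_forall fun ω => ?_)
  simp only
  ring

end Malliavin

end

theorem lemma3p2 {H : Type*} [NormedAddCommGroup H] [InnerProductSpace ℝ H] [CompleteSpace H]
    [TopologicalSpace.SeparableSpace H]
    {Ω : Type*} [MeasurableSpace Ω] (P : Measure Ω) [IsProbabilityMeasure P]
    (ξ : H → Ω → ℝ) (hξ : Malliavin.IsIsonormal ξ P)
    (x : Ω → H) (Dx : Ω → H →L[ℝ] H) (D2x : Ω → H →L[ℝ] H →L[ℝ] H)
    (hx : Malliavin.HasTwoStochDerivs ξ P x Dx D2x) :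
    -- the integral of x exists
    (∃ Ix, Malliavin.HasIntegral ξ P x Ix) ∧
    ∀ Ix, Malliavin.HasIntegral ξ P x Ix →
      -- the product formula
      (∀ (α : Ω → ℝ) (Dα : Ω → H), Malliavin.HasStochDeriv ξ P α Dα →
        (∃ C : ℝ, ∀ᵐ ω ∂P, |α ω| ≤ C) →
        (∃ J, Malliavin.HasIntegralL1 ξ P (fun ω => α ω • x ω) J) ∧
        (∀ J, Malliavin.HasIntegralL1 ξ P (fun ω => α ω • x ω) J →
          (fun ω => α ω * Ix ω) =ᵐ[P] fun ω => J ω + ⟪x ω, Dα ω⟫) ∧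
        ((∃ J, Malliavin.HasIntegral ξ P (fun ω => α ω • x ω) J) ↔
          MemLp (fun ω => ⟪x ω, Dα ω⟫) 2 P)) ∧
      -- the commutation relation
      (∃ DIx, Malliavin.HasStochDeriv ξ P Ix DIx) ∧
      ∀ h : H,
        (∃ J, Malliavin.HasIntegral ξ P (fun ω => Dx ω h) J) ∧
        ∀ DIx J, Malliavin.HasStochDeriv ξ P Ix DIx →
          Malliavin.HasIntegral ξ P (fun ω => Dx ω h) J →
          (fun ω => ⟪DIx ω, h⟫) =ᵐ[P] fun ω => ⟪x ω, h⟫ + J ω := by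
  obtain ⟨Ix₀, DIx₀, hI₀, hD₀, hJ₀⟩ := hx.exists_integral hξ
  refine ⟨⟨Ix₀, hI₀⟩, fun Ix hI => ⟨fun α Dα hα hb => ?_, ?_⟩⟩
  · have hJ := hI.smul hξ hα hb
    -- Since α I(x) is always in L², the L² criterion is a matter of subtracting: I(αx) and (x, Dα)
    -- are in L² together.
    have hαI : MemLp (fun ω => α ω * Ix ω) 2 P := by
      obtain ⟨C, hC⟩ := hb
      exact Malliavin.memLp_bdd_smul hI.2 hα.1.1 hC
    refine ⟨⟨_, hJ⟩, fun J hJ' => ?_, ⟨fun ⟨J, hJ'⟩ => ?_, fun hm => ⟨_, hJ, hαI.sub hm⟩⟩⟩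
    · filter_upwards [hJ.ae_eq hξ hJ'] with ω hω
      rw [← hω, sub_add_cancel]
    · refine (hαI.sub hJ'.2).ae_eq ?_
      filter_upwards [hJ.ae_eq hξ hJ'.1] with ω hω
      rw [Pi.sub_apply, ← hω, sub_sub_cancel]
  · have hII : Ix₀ =ᵐ[P] Ix := hI₀.1.ae_eq hξ hI.1
    -- The constructed derivative is carried over to the given version of I(x); uniqueness of
    -- derivative and integral then handles arbitrary versions.
    have hD : Malliavin.HasStochDeriv ξ P Ix DIx₀ := hD₀.congr hII EventuallyEq.rfl
    refine ⟨⟨DIx₀, hD⟩, fun h => ⟨⟨_, hJ₀ h⟩, fun DIx J hDIx hJ => ?_⟩⟩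
    filter_upwards [hD.inner_ae_eq hξ hDIx h, (hJ₀ h).1.ae_eq hξ hJ.1] with ω h1 h2
    rw [← h1, ← h2, add_sub_cancel]
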